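/- For a finite simple connected graph $G$, let $\kappa(G)=\sum_{v} m_{uv}\,\pi(v)$ be Kemeny's constant of the simple random walk on $G$, where $m_{uv}$ is the mean first passage time from $u$ to $v$ (with $m_{uu}=0$) and $\pi(v)=\deg(v)/(2|E(G)|)$ is the stationary distribution; the sum does not depend on $u$. A pair of distinct nonadjacent vertices $\{u,v\}$ is a Braess edge of $G$ if inserting the edge $\{u,v\}$ into $G$ strictly increases Kemeny's constant, and $B(G)$ denotes the number of Braess edges of $G$. For $k\ge 1$ and $p\ge 2$, the broom $\mathcal B_{k,p}$ is the tree on $k+p$ vertices obtained from the path $\mathcal P_k=(1,\dots,k)$ by attaching $p$ pendent vertices to the end vertex $k$. Let $B_1$, $B_2$ and $B_3$ be the numbers of Braess edges of $\mathcal B_{k,p}$ joining, respectively, two of the $p$ attached pendent vertices, an attached pendent vertex and a vertex of $\mathcal P_k$, and two vertices of $\mathcal P_k$. **Theorem 5.1.** 1. $B_1=\frac{p(p-1)}2$ for all $k\ge 1$, $p\ge 2$ with $k+p\ge 4$. 2. $B_2=O(k)$: there is an absolute constant $C>0$ such that $B_2\le Ck$ for all $k\ge 3$ and $p\ge 2$.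 3. $B_3=\Theta(k\ln k)$ as $k\to\infty$, uniformly in $p$: there are absolute constants $c,C>0$ and $K$ such that $c\,k\ln k\le B_3\le C\,k\ln k$ for all $k\ge K$ and $p\ge 2$. 4. Hence, along any sequence of pairs $(k,p)$ with $p\ge 2$ and $k\to\infty$: - if $p/k\to 0$, then $B(\mathcal B_{k,p})=\Theta(k\ln k+p^2)$; - if $p/k\to\beta$ for some $\beta\in(0,\infty]$, then $B(\mathcal B_{k,p})\sim\frac12p^2$. -/

import Mathlib

open Filter Asymptotics
open scoped ENNReal Topology

namespace BraessTree

noncomputable section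

variable {V : Type*} [Fintype V]

open Classical in
/-- Transition probabilities of the simple random walk on `G`. -/
def step (G : SimpleGraph V) (u v : V) : ℝ≥0∞ :=
  if G.Adj u v then (G.degree u : ℝ≥0∞)⁻¹ else 0

open Classical in
/-- `notHit G t u v` is the probability that the random walk on `G` started at `u` has not visited
`v` at any of the times `0, 1, …, t`, i.e. that the first passage time to `v` exceeds `t`. -/
def notHit (G : SimpleGraph V) : ℕ → V → V → ℝ≥0∞
  | 0, u, v => if u = v then 0 else 1
  | t + 1, u, v => if u = v then 0 else ∑ w, step G u w * notHit G t w v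

/-- Mean first passage time from `u` to `v`: the expectation `∑ₜ P(T > t)` of the first passage
time `T` (so that it is `0` when `u = v`). -/
def meanFirstPassage (G : SimpleGraph V) (u v : V) : ℝ≥0∞ :=
  ∑' t : ℕ, notHit G t u v

open Classical in
/-- The stationary distribution of the random walk on `G`: degree over the sum of all degrees. -/
def stationary (G : SimpleGraph V) (v : V) : ℝ≥0∞ :=
  (G.degree v : ℝ≥0∞) / ∑ w, (G.degree w : ℝ≥0∞)

/-- `κ` is Kemeny's constant of `G`: the common value, over all initial states `u`,
of `∑ᵥ m(u, v) π(v)`. -/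
def IsKemenyConstant (G : SimpleGraph V) (κ : ℝ≥0∞) : Prop :=
  ∀ u, ∑ v, meanFirstPassage G u v * stationary G v = κ

/-- The Braess edges of `G`: pairs of distinct nonadjacent vertices whose insertion as an edge
strictly increases Kemeny's constant. -/
def braessEdges (G : SimpleGraph V) : Set (Sym2 V) :=
  {e | ¬ e.IsDiag ∧ e ∉ G.edgeSet ∧
    ∃ κ κ' : ℝ≥0∞, IsKemenyConstant G κ ∧
      IsKemenyConstant (G ⊔ SimpleGraph.fromEdgeSet {e}) κ' ∧ κ < κ'}

/-- The number `B(G)` of Braess edges of `G`. -/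
def numBraess (G : SimpleGraph V) : ℕ := (braessEdges G).ncard

/-- The broom: the path on the `k` vertices `Sum.inl 0, …, Sum.inl (k - 1)`, with `p` pendent
vertices `Sum.inr a` attached to the last vertex of the path (the centre of the star). -/
def broom (k p : ℕ) : SimpleGraph (Fin k ⊕ Fin p) where
  Adj
    | .inl i, .inl j => (SimpleGraph.pathGraph k).Adj i j
    | .inl i, .inr _ => (i : ℕ) + 1 = k
    | .inr _, .inl i => (i : ℕ) + 1 = k
    | .inr _, .inr _ => False
  symm := ⟨by
    rintro (i | a) (j | b) h
    · exact SimpleGraph.Adj.symm (G := SimpleGraph.pathGraph k) h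
    · exact h
    · exact h
    · exact h⟩
  loopless := ⟨by
    rintro (i | a) h
    · exact SimpleGraph.irrefl (G := SimpleGraph.pathGraph k) h
    · exact h⟩

/-- Number of Braess edges of the broom joining two pendent vertices of the star. -/
def broomStar (k p : ℕ) : ℕ :=
  {e ∈ braessEdges (broom k p) | ∃ a b : Fin p, e = s(Sum.inr a, Sum.inr b)}.ncard

/-- Number of Braess edges of the broom joining a vertex of the path and a pendent vertex of the
star. -/
def broomMixed (k p : ℕ) : ℕ :=
  {e ∈ braessEdges (broom k p) | ∃ (i : Fin k) (a : Fin p), e = s(Sum.inl i, Sum.inr a)}.ncard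

/-- Number of Braess edges of the broom joining two vertices of the path. -/
def broomPath (k p : ℕ) : ℕ :=
  {e ∈ braessEdges (broom k p) | ∃ i j : Fin k, e = s(Sum.inl i, Sum.inl j)}.ncard

/-- On a graph with at least one edge, `stationary` is a probability distribution. -/
theorem sum_stationary (G : SimpleGraph V) {u v : V} (h : G.Adj u v) :
    ∑ w, stationary G w = 1 := by
  classical
  unfold stationary
  simp only [div_eq_mul_inv]
  rw [← Finset.sum_mul]
  apply ENNReal.mul_inv_cancel
  · intro h0
    have h1 := Finset.sum_eq_zero_iff.1 h0 u (Finset.mem_univ u)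
    have h2 : 0 < G.degree u := (G.degree_pos_iff_exists_adj u).2 ⟨v, h⟩
    have h3 : G.degree u = 0 := by
      convert (Nat.cast_eq_zero (R := ℝ≥0∞)).1 h1
    omega
  · exact ENNReal.sum_ne_top.2 fun w _ => ENNReal.natCast_ne_top _

/-- `stationary` is invariant under a step of the random walk. -/
theorem sum_stationary_mul_step (G : SimpleGraph V) (v : V) :
    ∑ u, stationary G u * step G u v = stationary G v := by
  classical
  have key : ∀ u, stationary G u * step G u v =
      (if G.Adj v u then 1 else 0) * (∑ w, (G.degree w : ℝ≥0∞))⁻¹ := by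
    intro u
    unfold stationary step
    by_cases h : G.Adj u v
    · have h2 : 0 < G.degree u := (G.degree_pos_iff_exists_adj u).2 ⟨v, h⟩
      have h3 : (G.degree u : ℝ≥0∞) ≠ 0 := by
        simpa using h2.ne'
      rw [if_pos h, if_pos h.symm, div_eq_mul_inv, mul_right_comm]
      congr 1
      convert ENNReal.mul_inv_cancel h3 (ENNReal.natCast_ne_top _)
    · rw [if_neg h, if_neg (fun h' => h h'.symm)]
      simp
  rw [Finset.sum_congr rfl fun u _ => key u, ← Finset.sum_mul]
  unfold stationary
  rw [div_eq_mul_inv]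
  congr 1
  rw [Finset.sum_boole, ← SimpleGraph.card_neighborFinset_eq_degree]
  congr 2
  ext w
  simp

end

end BraessTree

/-! Kemeny's constant has an algebraic form: with effective resistances R, degrees d and D = ∑ d, it
equals ∑ d(x) d(y) R(x,y) / (2D) (`isKemenyConstant_of_resistance`). Inserting an edge {u,v} changes
R by a rank-one correction (`isResistance_addRes`) and D by 2. So {u,v} is a Braess edge exactly
when an explicit inequality in R holds (`mem_braessEdges_iff`). It weighs a gain, from the extra
stationary mass at u and v, against a loss, from the shorter resistances, divided by 1 + R(u,v). In
a tree R is the distance, so on the broom every sum is a polynomial. Throughout, K = k - 1 is the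
number of path edges, the index K is the centre of the star, and there are K + p edges in all. Two
pendent vertices: the criterion is a polynomial inequality that always holds once k + p ≥ 4. A
pendent vertex and the path vertex at distance t from the centre: the loss has order p t (K +
p)-like growth, and the criterion forces p (t + 1) ≤ 959 K (`mul_le_of_mixed`). Each of the p
pendent vertices thus has O(K/p) partners, which makes O(K) pairs. Two path vertices at distance r,
with b path edges beyond one and s between the other and the centre: the leading loss is of order r
(p + s) b, against a gain of order K (K + p). Hence a Braess edge needs r b or r s to be O(K)
(`path_upper`), while r b and r² both small against K suffice (`path_lower`). Counting lattice
points under a hyperbola gives harmonic sums, hence k log k. Together the counts give p²/2 - p/2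
plus a term of exact order k log k, from which both asymptotic regimes follow. -/

namespace BraessTree

noncomputable section

/-! ### Laplacians and resistance equations on a finite graph -/

section Network

variable {V : Type*}

open Classical in
/-- The adjacency matrix of `G` with real entries. -/
def adjW (G : SimpleGraph V) (u w : V) : ℝ := if G.Adj u w then 1 else 0

theorem adjW_nonneg (G : SimpleGraph V) (u w : V) : 0 ≤ adjW G u w := by
  unfold adjW; split_ifs <;> norm_num

open Classical in
theorem adjW_sup_edge {G : SimpleGraph V} {u v : V} (huv : u ≠ v) (hadj : ¬ G.Adj u v) (x w : V) :
    adjW (G ⊔ SimpleGraph.fromEdgeSet {s(u, v)}) x w =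
      adjW G x w + (if x = u then if w = v then 1 else 0 else 0) +
        (if x = v then if w = u then 1 else 0 else 0) := by
  have hadj' : ¬ G.Adj v u := fun h => hadj h.symm
  unfold adjW
  simp only [SimpleGraph.sup_adj, SimpleGraph.fromEdgeSet_adj, Set.mem_singleton_iff,
    Sym2.eq_iff]
  by_cases h1 : x = u
  · subst h1
    by_cases h2 : w = v
    · subst h2
      simp [hadj, huv]
    · simp [h2, huv]
  · by_cases h2 : x = v
    · subst h2
      by_cases h3 : w = u
      · subst h3
        simp [hadj', h1]
      · simp [h1, h3]
    · simp [h1, h2]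

variable [Fintype V]

/-- The degree of a vertex as a real number. -/
def wdeg (G : SimpleGraph V) (u : V) : ℝ := ∑ w, adjW G u w

/-- The sum of `g` weighted by the degrees. -/
def degSum (G : SimpleGraph V) (g : V → ℝ) : ℝ := ∑ x, wdeg G x * g x

/-- The Laplacian of `G` applied to `g`. -/
def lap (G : SimpleGraph V) (g : V → ℝ) (x : V) : ℝ := ∑ w, adjW G x w * (g x - g w)

open Classical in
/-- `R` satisfies the equations of the effective resistances of `G`. -/
structure IsResistance (G : SimpleGraph V) (R : V → V → ℝ) (τ : V → ℝ) : Prop where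
  symm : ∀ x y, R x y = R y x
  diag : ∀ x, R x x = 0
  lap_eq : ∀ x z, lap G (fun y => R y z) x = τ x - if x = z then 2 else 0

theorem wdeg_nonneg (G : SimpleGraph V) (u : V) : 0 ≤ wdeg G u :=
  Finset.sum_nonneg fun w _ => adjW_nonneg G u w

theorem natCast_degree (G : SimpleGraph V) (u : V) [Fintype (G.neighborSet u)] :
    (G.degree u : ℝ) = wdeg G u := by
  classical
  unfold wdeg adjW
  rw [Finset.sum_boole, ← SimpleGraph.card_neighborFinset_eq_degree]
  congr 2
  ext w
  simp

theorem natCast_degree_ennreal (G : SimpleGraph V) (u : V) [Fintype (G.neighborSet u)] :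
    (G.degree u : ℝ≥0∞) = ENNReal.ofReal (wdeg G u) := by
  rw [← natCast_degree, ENNReal.ofReal_natCast]

theorem wdeg_pos_of_adj {G : SimpleGraph V} {u w : V} (h : G.Adj u w) : 0 < wdeg G u := by
  classical
  rw [← natCast_degree]
  exact_mod_cast (G.degree_pos_iff_exists_adj u).2 ⟨w, h⟩

theorem step_eq (G : SimpleGraph V) (u w : V) :
    step G u w = ENNReal.ofReal (adjW G u w / wdeg G u) := by
  classical
  unfold step
  by_cases h : G.Adj u w
  · rw [if_pos h, natCast_degree_ennreal, ← ENNReal.ofReal_inv_of_pos (wdeg_pos_of_adj h)]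
    simp [adjW, h]
  · simp [adjW, h]

theorem stationary_eq (G : SimpleGraph V) (v : V) (hD : 0 < ∑ x, wdeg G x) :
    stationary G v = ENNReal.ofReal (wdeg G v / ∑ x, wdeg G x) := by
  classical
  unfold stationary
  rw [ENNReal.ofReal_div_of_pos hD, ENNReal.ofReal_sum_of_nonneg fun x _ => wdeg_nonneg G x]
  simp only [natCast_degree_ennreal]

theorem lap_eq_sub (G : SimpleGraph V) (g : V → ℝ) (x : V) :
    lap G g x = wdeg G x * g x - ∑ w, adjW G x w * g w := by
  unfold lap wdeg
  rw [Finset.sum_mul, ← Finset.sum_sub_distrib]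
  exact Finset.sum_congr rfl fun w _ => by ring

/-- Minimum principle: a function superharmonic off `v` and zero at `v` is nonnegative. -/
theorem nonneg_of_lap_nonneg {G : SimpleGraph V} (hG : G.Connected) {f : V → ℝ} {v : V}
    (hv : f v = 0) (hf : ∀ u, u ≠ v → 0 ≤ lap G f u) (u : V) : 0 ≤ f u := by
  have := hG.nonempty
  obtain ⟨x, hx⟩ := Finite.exists_min f
  -- Superharmonicity at a minimiser forces every neighbour to be a minimiser, so the minimum
  -- travels along a walk until it reaches `v`, where `f` vanishes.
  have key : ∀ y z : V, G.Walk y z → z = v → f y = f x → 0 ≤ f x := by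
    intro y z W
    induction W with
    | nil => intro h1 h2; rw [← h2, h1, hv]
    | @cons a b c hab W ih =>
      intro h1 h2
      by_cases hav : a = v
      · rw [← h2, hav, hv]
      · refine ih h1 ?_
        have h3 := hf a hav
        have h4 : ∀ w ∈ Finset.univ, adjW G a w * (f a - f w) ≤ 0 := fun w _ =>
          mul_nonpos_of_nonneg_of_nonpos (adjW_nonneg G a w) (by rw [h2]; linarith [hx w])
        have h5 := (Finset.sum_eq_zero_iff_of_nonpos h4).1
          (le_antisymm (Finset.sum_nonpos h4) h3) b (Finset.mem_univ b)
        have h6 : adjW G a b = 1 := by simp [adjW, hab]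
        rw [h6] at h5
        linarith
  obtain ⟨W⟩ := hG.preconnected x v
  exact (key x v W rfl rfl).trans (hx u)

/-! ### First passage times and Kemeny's constant -/

theorem meanFirstPassage_self (G : SimpleGraph V) (v : V) : meanFirstPassage G v v = 0 := by
  unfold meanFirstPassage
  rw [ENNReal.tsum_eq_zero]
  intro t
  cases t <;> simp [notHit]

theorem meanFirstPassage_of_ne (G : SimpleGraph V) {u v : V} (h : u ≠ v) :
    meanFirstPassage G u v = 1 + ∑ w, step G u w * meanFirstPassage G w v := by
  unfold meanFirstPassage
  rw [tsum_eq_zero_add' ENNReal.summable]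
  congr 1
  · simp [notHit, h]
  · simp only [notHit, if_neg h]
    rw [Summable.tsum_finsetSum fun _ _ => ENNReal.summable]
    exact Finset.sum_congr rfl fun w _ => ENNReal.tsum_mul_left

theorem sum_notHit_succ (G : SimpleGraph V) {u v : V} (h : u ≠ v) (T : ℕ) :
    ∑ t ∈ Finset.range (T + 1), notHit G t u v =
      1 + ∑ w, step G u w * ∑ t ∈ Finset.range T, notHit G t w v := by
  rw [Finset.sum_range_succ', add_comm]
  congr 1
  · simp [notHit, h]
  · simp only [notHit, if_neg h, Finset.mul_sum]
    exact Finset.sum_comm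

/-- The mean first passage times are determined by the first step equations. -/
theorem meanFirstPassage_eq {G : SimpleGraph V} (hG : G.Connected) {h : V → ℝ} {v : V}
    (hv : h v = 0) (hh : ∀ u, u ≠ v → lap G h u = wdeg G u) (u : V) :
    meanFirstPassage G u v = ENNReal.ofReal (h u) := by
  have h0 : ∀ x, 0 ≤ h x := nonneg_of_lap_nonneg hG hv fun x hx => by
    rw [hh x hx]; exact wdeg_nonneg G x
  have hd : ∀ x, x ≠ v → 0 < wdeg G x := by
    intro x hx
    obtain ⟨W⟩ := hG.preconnected x v
    cases W with
    | nil => exact absurd rfl hx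
    | cons hab _ => exact wdeg_pos_of_adj hab
  have hs : ∀ x, x ≠ v → ∀ g : V → ℝ, (∀ w, 0 ≤ g w) →
      1 + ∑ w, step G x w * ENNReal.ofReal (g w) =
        ENNReal.ofReal (1 + (∑ w, adjW G x w * g w) / wdeg G x) := by
    intro x hx g hg
    have hq : ∀ w, 0 ≤ adjW G x w / wdeg G x := fun w =>
      div_nonneg (adjW_nonneg G x w) (hd x hx).le
    rw [ENNReal.ofReal_add zero_le_one (div_nonneg (Finset.sum_nonneg fun w _ =>
      mul_nonneg (adjW_nonneg G x w) (hg w)) (hd x hx).le), ENNReal.ofReal_one, Finset.sum_div,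
      ENNReal.ofReal_sum_of_nonneg fun w _ => div_nonneg (mul_nonneg (adjW_nonneg G x w) (hg w))
        (hd x hx).le]
    congr 1
    refine Finset.sum_congr rfl fun w _ => ?_
    rw [step_eq, ← ENNReal.ofReal_mul (hq w)]
    congr 1
    ring
  have hfix : ∀ x, x ≠ v → h x = 1 + (∑ w, adjW G x w * h w) / wdeg G x := by
    intro x hx
    have h1 := hh x hx
    have h2 := hd x hx
    rw [lap_eq_sub] at h1
    field_simp
    linarith
  -- A nonnegative solution dominates all partial sums of the tail probabilities. This makes the
  -- passage times finite, so that they can be compared with `h` in the reals.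
  have hle : ∀ T x, ∑ t ∈ Finset.range T, notHit G t x v ≤ ENNReal.ofReal (h x) := by
    intro T
    induction T with
    | zero => intro x; simp
    | succ T ih =>
      intro x
      by_cases hx : x = v
      · subst hx
        rw [Finset.sum_eq_zero]
        · exact zero_le
        · intro t _
          cases t <;> simp [notHit]
      · rw [sum_notHit_succ G hx, hfix x hx, ← hs x hx h h0]
        gcongr with w
        exact ih w
  have hM : ∀ x, meanFirstPassage G x v ≤ ENNReal.ofReal (h x) := fun x =>
    ENNReal.tsum_le_of_sum_range_le fun T => hle T x
  have hT : ∀ x, meanFirstPassage G x v ≠ ⊤ := fun x =>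
    ((hM x).trans_lt ENNReal.ofReal_lt_top).ne
  set M : V → ℝ := fun x => (meanFirstPassage G x v).toReal with hMdef
  have hMo : ∀ x, meanFirstPassage G x v = ENNReal.ofReal (M x) := fun x =>
    (ENNReal.ofReal_toReal (hT x)).symm
  have hMv : M v = 0 := by simp [hMdef, meanFirstPassage_self]
  have hM0 : ∀ x, 0 ≤ M x := fun x => ENNReal.toReal_nonneg
  have hMl : ∀ x, x ≠ v → lap G M x = wdeg G x := by
    intro x hx
    have h1 := meanFirstPassage_of_ne G hx
    simp only [hMo] at h1
    rw [hs x hx M hM0, ENNReal.ofReal_eq_ofReal_iff (hM0 x) (by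
      have : 0 ≤ (∑ w, adjW G x w * M w) / wdeg G x := div_nonneg (Finset.sum_nonneg fun w _ =>
        mul_nonneg (adjW_nonneg G x w) (hM0 w)) (hd x hx).le
      linarith)] at h1
    have h2 := hd x hx
    rw [lap_eq_sub, h1]
    field_simp
    ring
  have hsub : ∀ (f g : V → ℝ) x, lap G (fun y => f y - g y) x = lap G f x - lap G g x := by
    intro f g x
    unfold lap
    rw [← Finset.sum_sub_distrib]
    exact Finset.sum_congr rfl fun w _ => by ring
  -- Uniqueness: `M - h` and its negative are harmonic off `v` and vanish at `v`.
  have e1 := nonneg_of_lap_nonneg (f := fun y => M y - h y) (v := v) hG (by simp [hMv, hv])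
    (fun x hx => by rw [hsub, hMl x hx, hh x hx, sub_self]) u
  have e2 := nonneg_of_lap_nonneg (f := fun y => h y - M y) (v := v) hG (by simp [hMv, hv])
    (fun x hx => by rw [hsub, hMl x hx, hh x hx, sub_self]) u
  rw [hMo u, show M u = h u by linarith]

theorem degSum_add (G : SimpleGraph V) (f g : V → ℝ) :
    degSum G (fun x => f x + g x) = degSum G f + degSum G g := by
  simp only [degSum, mul_add, Finset.sum_add_distrib]

theorem degSum_sub (G : SimpleGraph V) (f g : V → ℝ) :
    degSum G (fun x => f x - g x) = degSum G f - degSum G g := by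
  simp only [degSum, mul_sub, Finset.sum_sub_distrib]

theorem degSum_const_mul (G : SimpleGraph V) (c : ℝ) (f : V → ℝ) :
    degSum G (fun x => c * f x) = c * degSum G f := by
  simp only [degSum, Finset.mul_sum]
  exact Finset.sum_congr rfl fun x _ => by ring

theorem degSum_const (G : SimpleGraph V) (c : ℝ) :
    degSum G (fun _ => c) = c * ∑ x, wdeg G x := by
  simp only [degSum, Finset.mul_sum]
  exact Finset.sum_congr rfl fun x _ => by ring

theorem lap_sum (G : SimpleGraph V) {ι : Type*} (s : Finset ι) (c : ι → ℝ) (f : ι → V → ℝ)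
    (x : V) : lap G (fun y => ∑ i ∈ s, c i * f i y) x = ∑ i ∈ s, c i * lap G (f i) x := by
  unfold lap
  simp only [← Finset.sum_sub_distrib, Finset.mul_sum]
  rw [Finset.sum_comm]
  exact Finset.sum_congr rfl fun i _ => Finset.sum_congr rfl fun w _ => by ring

/-- The term `τ` does not depend on the second argument of `R`, so it cancels in R(y,v) - R(y,z) and
leaves a point mass 2 at z. Averaging with weights deg(z)/2 then solves the first step equations. -/
theorem meanFirstPassage_eq_resistance {G : SimpleGraph V} (hG : G.Connected) {R : V → V → ℝ}
    {τ : V → ℝ} (hR : IsResistance G R τ) (u v : V) :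
    meanFirstPassage G u v =
      ENNReal.ofReal (∑ z, wdeg G z / 2 * (R u v + R v z - R u z)) := by
  classical
  refine meanFirstPassage_eq (h := fun u => ∑ z, wdeg G z / 2 * (R u v + R v z - R u z)) hG ?_ ?_ u
  · exact Finset.sum_eq_zero fun z _ => by rw [hR.diag]; ring
  · intro x hx
    rw [lap_sum G Finset.univ (fun z => wdeg G z / 2) (fun z y => R y v + R v z - R y z)]
    have h1 : ∀ z, lap G (fun y => R y v + R v z - R y z) x = if x = z then 2 else 0 := by
      intro z
      have h2 := hR.lap_eq x v
      have h3 := hR.lap_eq x z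
      have h4 : lap G (fun y => R y v + R v z - R y z) x =
          lap G (fun y => R y v) x - lap G (fun y => R y z) x := by
        unfold lap
        rw [← Finset.sum_sub_distrib]
        exact Finset.sum_congr rfl fun w _ => by ring
      rw [h4, h2, h3, if_neg hx]
      ring
    simp only [h1]
    simp

/-- Kemeny's constant in terms of effective resistances. -/
theorem isKemenyConstant_of_resistance {G : SimpleGraph V} (hG : G.Connected) {R : V → V → ℝ}
    {τ : V → ℝ} (hR : IsResistance G R τ) (hD : 0 < ∑ x, wdeg G x) :
    IsKemenyConstant G (ENNReal.ofReal
      (degSum G (fun x => degSum G (fun y => R x y)) / (2 * ∑ x, wdeg G x))) := by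
  intro u
  have hpos : ∀ v, 0 ≤ ∑ z, wdeg G z / 2 * (R u v + R v z - R u z) := by
    intro v
    refine nonneg_of_lap_nonneg
      (f := fun u => ∑ z, wdeg G z / 2 * (R u v + R v z - R u z)) hG (v := v) ?_ ?_ u
    · exact Finset.sum_eq_zero fun z _ => by rw [hR.diag]; ring
    · intro x hx
      classical
      rw [lap_sum G Finset.univ (fun z => wdeg G z / 2) (fun z y => R y v + R v z - R y z)]
      refine Finset.sum_nonneg fun z _ => mul_nonneg (by linarith [wdeg_nonneg G z]) ?_
      have h2 := hR.lap_eq x v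
      have h3 := hR.lap_eq x z
      have h4 : lap G (fun y => R y v + R v z - R y z) x =
          lap G (fun y => R y v) x - lap G (fun y => R y z) x := by
        unfold lap
        rw [← Finset.sum_sub_distrib]
        exact Finset.sum_congr rfl fun w _ => by ring
      rw [h4, h2, h3, if_neg hx]
      split_ifs <;> simp
  have h1 : ∀ v, meanFirstPassage G u v * stationary G v = ENNReal.ofReal
      ((∑ z, wdeg G z / 2 * (R u v + R v z - R u z)) * (wdeg G v / ∑ x, wdeg G x)) := by
    intro v
    rw [meanFirstPassage_eq_resistance hG hR, stationary_eq G v hD, ← ENNReal.ofReal_mul (hpos v)]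
  simp only [h1]
  rw [← ENNReal.ofReal_sum_of_nonneg fun v _ =>
    mul_nonneg (hpos v) (div_nonneg (wdeg_nonneg G v) hD.le)]
  congr 1
  set D := ∑ x, wdeg G x with hDdef
  have h2 : ∀ v, ∑ z, wdeg G z / 2 * (R u v + R v z - R u z) =
      (D * R u v + degSum G (fun z => R v z) - degSum G (fun z => R u z)) / 2 := by
    intro v
    simp only [degSum, hDdef, Finset.sum_mul, ← Finset.sum_add_distrib, ← Finset.sum_sub_distrib,
      Finset.sum_div]
    exact Finset.sum_congr rfl fun z _ => by ring
  simp only [h2]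
  have h3 : ∑ v, (D * R u v + degSum G (fun z => R v z) - degSum G (fun z => R u z)) / 2 *
      (wdeg G v / D) = degSum G (fun v => D * R u v + degSum G (fun z => R v z) -
        degSum G (fun z => R u z)) / (2 * D) := by
    generalize degSum G (fun z => R u z) = c
    rw [degSum, Finset.sum_div]
    exact Finset.sum_congr rfl fun v _ => by field_simp
  -- The two terms involving `u` cancel here, which is why the initial state does not matter.
  rw [h3, degSum_sub, degSum_add, degSum_const_mul, degSum_const]
  congr 1
  ring

/-! ### Inserting an edge -/

/-- The effective resistances after inserting the edge `{u, v}`. -/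
def addRes (R : V → V → ℝ) (u v x y : V) : ℝ :=
  R x y - ((R x u - R x v) - (R y u - R y v)) ^ 2 / (4 * (1 + R u v))

open Classical in
theorem wdeg_sup_edge {G : SimpleGraph V} {u v : V} (huv : u ≠ v) (hadj : ¬ G.Adj u v) (x : V) :
    wdeg (G ⊔ SimpleGraph.fromEdgeSet {s(u, v)}) x =
      wdeg G x + (if x = u then 1 else 0) + (if x = v then 1 else 0) := by
  unfold wdeg
  simp only [adjW_sup_edge huv hadj, Finset.sum_add_distrib]
  congr 1
  · congr 1
    split_ifs <;> simp
  · split_ifs <;> simp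

theorem degSum_sup_edge {G : SimpleGraph V} {u v : V} (huv : u ≠ v) (hadj : ¬ G.Adj u v)
    (g : V → ℝ) :
    degSum (G ⊔ SimpleGraph.fromEdgeSet {s(u, v)}) g = degSum G g + g u + g v := by
  classical
  unfold degSum
  simp only [wdeg_sup_edge huv hadj, add_mul, Finset.sum_add_distrib]
  simp

open Classical in
theorem lap_sup_edge {G : SimpleGraph V} {u v : V} (huv : u ≠ v) (hadj : ¬ G.Adj u v)
    (g : V → ℝ) (x : V) :
    lap (G ⊔ SimpleGraph.fromEdgeSet {s(u, v)}) g x = lap G g x +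
      ((if x = u then 1 else 0) - (if x = v then 1 else 0)) * (g u - g v) := by
  unfold lap
  simp only [adjW_sup_edge huv hadj, add_mul, Finset.sum_add_distrib]
  by_cases h1 : x = u
  · subst h1; simp [huv]
  · by_cases h2 : x = v
    · subst h2; simp [h1]
    · simp [h1, h2]

/-- This is the Sherman–Morrison update. With f = R(·,u) - R(·,v), the square of f(y) goes into the
new `τ` and that of f(z) is constant in y. The cross term cancels the current f(z)/(1 + R(u,v))
through the new edge. -/
theorem isResistance_addRes {G : SimpleGraph V} {R : V → V → ℝ} {τ : V → ℝ}
    (hR : IsResistance G R τ) {u v : V} (huv : u ≠ v) (hadj : ¬ G.Adj u v) (hr : 0 ≤ R u v) :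
    IsResistance (G ⊔ SimpleGraph.fromEdgeSet {s(u, v)}) (addRes R u v)
      (fun x => τ x - lap G (fun y => (R y u - R y v) ^ 2) x / (4 * (1 + R u v))) := by
  classical
  refine ⟨fun x y => ?_, fun x => ?_, fun x z => ?_⟩
  · unfold addRes; rw [hR.symm x y]; ring
  · unfold addRes; rw [hR.diag]; ring
  · rw [lap_sup_edge huv hadj]
    have e1 : lap G (fun y => addRes R u v y z) x = lap G (fun y => R y z) x -
        (lap G (fun y => (R y u - R y v) ^ 2) x - 2 * (R z u - R z v) *
          (lap G (fun y => R y u) x - lap G (fun y => R y v) x)) / (4 * (1 + R u v)) := by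
      unfold lap addRes
      rw [← Finset.sum_sub_distrib, Finset.mul_sum, ← Finset.sum_sub_distrib, Finset.sum_div,
        ← Finset.sum_sub_distrib]
      exact Finset.sum_congr rfl fun w _ => by ring
    rw [e1, hR.lap_eq, hR.lap_eq, hR.lap_eq]
    have hne : (1 + R u v) ≠ 0 := by positivity
    unfold addRes
    rw [hR.diag u, hR.diag v, hR.symm v u, hR.symm u z, hR.symm v z]
    generalize (if x = z then (2 : ℝ) else 0) = c
    have hu : (if x = u then (2 : ℝ) else 0) = 2 * (if x = u then (1 : ℝ) else 0) := by
      split_ifs <;> norm_num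
    have hv : (if x = v then (2 : ℝ) else 0) = 2 * (if x = v then (1 : ℝ) else 0) := by
      split_ifs <;> norm_num
    rw [hu, hv]
    field_simp
    ring

/-- Inserting `{u, v}` strictly increases Kemeny's constant iff an explicit inequality between
effective resistances holds. -/
theorem mem_braessEdges_iff {G : SimpleGraph V} (hG : G.Connected) {R : V → V → ℝ} {τ : V → ℝ}
    (hR : IsResistance G R τ) (hR0 : ∀ x y, 0 ≤ R x y) (hD : 0 < ∑ x, wdeg G x) {u v : V}
    (huv : u ≠ v) (hadj : ¬ G.Adj u v) :
    s(u, v) ∈ braessEdges G ↔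
      2 * degSum G (fun x => degSum G (fun y => R x y)) < (∑ x, wdeg G x) *
        (2 * (degSum G (fun x => R x u) + degSum G (fun x => R x v)) + 2 * R u v -
          ((∑ x, wdeg G x + 2) * (degSum G (fun x => (R x u - R x v) ^ 2) + 2 * R u v ^ 2) -
            degSum G (fun x => R x u - R x v) ^ 2) / (2 * (1 + R u v))) := by
  classical
  have := hG.nonempty
  obtain ⟨x₀⟩ := this
  set G' := G ⊔ SimpleGraph.fromEdgeSet {s(u, v)} with hG'
  have hGc : G'.Connected := hG.mono le_sup_left
  have hD' : ∑ x, wdeg G' x = ∑ x, wdeg G x + 2 := by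
    have h := degSum_sup_edge huv hadj (fun _ => 1)
    simp only [degSum, mul_one] at h
    rw [hG', h]
    ring
  have k1 := isKemenyConstant_of_resistance hG hR hD
  have k2 := isKemenyConstant_of_resistance hGc (isResistance_addRes hR huv hadj (hR0 u v))
    (by rw [hD']; linarith)
  have hA0 : 0 ≤ degSum G (fun x => degSum G (fun y => R x y)) :=
    Finset.sum_nonneg fun x _ => mul_nonneg (wdeg_nonneg G x) <|
      Finset.sum_nonneg fun y _ => mul_nonneg (wdeg_nonneg G y) (hR0 x y)
  have hA' : degSum G' (fun x => degSum G' (fun y => addRes R u v x y)) =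
      degSum G (fun x => degSum G (fun y => R x y)) +
        (2 * (degSum G (fun x => R x u) + degSum G (fun x => R x v)) + 2 * R u v -
          ((∑ x, wdeg G x + 2) * (degSum G (fun x => (R x u - R x v) ^ 2) + 2 * R u v ^ 2) -
            degSum G (fun x => R x u - R x v) ^ 2) / (2 * (1 + R u v))) := by
    set f : V → ℝ := fun x => R x u - R x v with hf
    set D := ∑ x, wdeg G x
    have a1 : ∀ x, degSum G' (fun y => addRes R u v x y) =
        degSum G (fun y => R x y) + R x u + R x v -
          (1 / (4 * (1 + R u v))) * ((D + 2) * f x ^ 2 - 2 * degSum G f * f x +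
            (degSum G (fun x => f x ^ 2) + 2 * R u v ^ 2)) := by
      intro x
      have b1 : (fun y => addRes R u v x y) = fun y => R x y - (1 / (4 * (1 + R u v))) *
          (f x ^ 2 - (2 * f x) * f y + f y ^ 2) := by
        funext y
        simp only [addRes, hf]
        ring
      rw [b1, degSum_sub, degSum_const_mul, degSum_add, degSum_sub, degSum_const_mul,
        degSum_const, hD']
      rw [degSum_sup_edge huv hadj, degSum_sup_edge huv hadj, degSum_sup_edge huv hadj]
      have c1 : f u = - R u v := by simp [hf, hR.diag]
      have c2 : f v = R u v := by simp [hf, hR.diag, hR.symm v u]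
      rw [c1, c2]
      ring
    simp only [a1]
    rw [degSum_sub, degSum_const_mul, degSum_add, degSum_add, degSum_add, degSum_sub,
      degSum_const_mul, degSum_const_mul, degSum_const, hD']
    simp only [hG', degSum_sup_edge huv hadj]
    have c1 : f u = - R u v := by simp [hf, hR.diag]
    have c2 : f v = R u v := by simp [hf, hR.diag, hR.symm v u]
    have c3 : degSum G (fun y => R u y) = degSum G (fun x => R x u) := by simp only [hR.symm u]
    have c4 : degSum G (fun y => R v y) = degSum G (fun x => R x v) := by simp only [hR.symm v]
    rw [c1, c2, c3, c4, hR.diag, hR.diag, hR.symm v u]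
    have hne : (1 + R u v) ≠ 0 := by have := hR0 u v; positivity
    field_simp
    ring
  rw [hA', hD'] at k2
  set A := degSum G (fun x => degSum G (fun y => R x y))
  set D := ∑ x, wdeg G x
  generalize (2 * (degSum G (fun x => R x u) + degSum G (fun x => R x v)) + 2 * R u v -
          ((D + 2) * (degSum G (fun x => (R x u - R x v) ^ 2) + 2 * R u v ^ 2) -
            degSum G (fun x => R x u - R x v) ^ 2) / (2 * (1 + R u v))) = Δ at k2 ⊢
  -- `Δ` is the change of the double degree sum; the new edge adds 2 to the total degree.
  have hiff : A / (2 * D) < (A + Δ) / (2 * (D + 2)) ↔ 2 * A < D * Δ := by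
    rw [div_lt_div_iff₀ (by linarith) (by linarith)]
    constructor <;> intro h <;> nlinarith
  constructor
  · rintro ⟨-, -, κ, κ', h1, h2, h3⟩
    rw [← h1 x₀, ← h2 x₀, k1 x₀, k2 x₀] at h3
    exact hiff.1 ((ENNReal.ofReal_lt_ofReal_iff_of_nonneg (by positivity)).1 h3)
  · intro h
    refine ⟨by simpa using huv, by simpa using hadj, _, _, k1, k2, ?_⟩
    exact (ENNReal.ofReal_lt_ofReal_iff_of_nonneg (by positivity)).2 (hiff.2 h)

end Network

/-! ### The broom: adjacency, degree sums and distances -/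

section Broom

theorem sum_range_quadratic (n : ℕ) (c₀ c₁ c₂ : ℝ) :
    ∑ l ∈ Finset.range n, (c₀ + c₁ * l + c₂ * (l : ℝ) ^ 2) =
      c₀ * n + c₁ * (n * (n - 1) / 2) + c₂ * (n * (n - 1) * (2 * n - 1) / 6) := by
  induction n with
  | zero => simp
  | succ n ih => rw [Finset.sum_range_succ, ih]; push_cast; ring

theorem sum_range_eq_quadratic {n : ℕ} {f : ℕ → ℝ} (c₀ c₁ c₂ : ℝ)
    (h : ∀ l < n, f l = c₀ + c₁ * l + c₂ * (l : ℝ) ^ 2) :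
    ∑ l ∈ Finset.range n, f l =
      c₀ * n + c₁ * (n * (n - 1) / 2) + c₂ * (n * (n - 1) * (2 * n - 1) / 6) := by
  rw [← sum_range_quadratic]
  exact Finset.sum_congr rfl fun l hl => h l (Finset.mem_range.1 hl)

variable {K p : ℕ}

theorem broom_adj_inl_inl (i j : Fin (K + 1)) :
    (broom (K + 1) p).Adj (.inl i) (.inl j) ↔ (i : ℕ) + 1 = j ∨ (j : ℕ) + 1 = i :=
  SimpleGraph.pathGraph_adj

theorem broom_adj_inl_inr (i : Fin (K + 1)) (a : Fin p) :
    (broom (K + 1) p).Adj (.inl i) (.inr a) ↔ (i : ℕ) = K := by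
  show (i : ℕ) + 1 = K + 1 ↔ _
  omega

theorem broom_adj_inr_inl (i : Fin (K + 1)) (a : Fin p) :
    (broom (K + 1) p).Adj (.inr a) (.inl i) ↔ (i : ℕ) = K := by
  show (i : ℕ) + 1 = K + 1 ↔ _
  omega

theorem broom_adj_inr_inr (a b : Fin p) : ¬ (broom (K + 1) p).Adj (.inr a) (.inr b) := id

theorem broom_connected (K p : ℕ) : (broom (K + 1) p).Connected := by
  have h0 : ∀ n (hn : n < K + 1),
      (broom (K + 1) p).Reachable (.inl ⟨n, hn⟩) (.inl ⟨0, by omega⟩) := by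
    intro n
    induction n with
    | zero => intro _; exact SimpleGraph.Reachable.refl _
    | succ n ih =>
      intro hn
      exact (SimpleGraph.Adj.reachable ((broom_adj_inl_inl _ _).2 (Or.inr rfl))).trans
        (ih (by omega))
  have h1 : ∀ x, (broom (K + 1) p).Reachable x (.inl ⟨0, by omega⟩) := by
    rintro (i | a)
    · exact h0 i i.2
    · exact (SimpleGraph.Adj.reachable ((broom_adj_inr_inl ⟨K, by omega⟩ a).2 rfl)).trans (h0 K _)
  exact { preconnected := fun x y => (h1 x).trans (h1 y).symm
          nonempty := ⟨.inl ⟨0, by omega⟩⟩ }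

theorem sum_adjW_inr (a : Fin p) (g : Fin (K + 1) ⊕ Fin p → ℝ) {φ : ℕ → ℝ}
    (hφ : ∀ i : Fin (K + 1), g (.inl i) = φ i) :
    ∑ w, adjW (broom (K + 1) p) (.inr a) w * g w = φ K := by
  rw [Fintype.sum_sum_type]
  simp only [adjW, broom_adj_inr_inl, broom_adj_inr_inr, if_false, zero_mul, hφ,
    Finset.sum_const_zero, add_zero]
  rw [Fin.sum_univ_eq_sum_range (fun i => (if i = K then (1 : ℝ) else 0) * φ i)]
  simp

theorem sum_adjW_inl (i : Fin (K + 1)) (g : Fin (K + 1) ⊕ Fin p → ℝ) {φ : ℕ → ℝ}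
    (hφ : ∀ i : Fin (K + 1), g (.inl i) = φ i) :
    ∑ w, adjW (broom (K + 1) p) (.inl i) w * g w =
      (if (i : ℕ) < K then φ (i + 1) else 0) + (if 0 < (i : ℕ) then φ (i - 1) else 0) +
        (if (i : ℕ) = K then ∑ a, g (.inr a) else 0) := by
  rw [Fintype.sum_sum_type]
  simp only [adjW, broom_adj_inl_inl, broom_adj_inl_inr, hφ]
  congr 1
  · rw [Fin.sum_univ_eq_sum_range
      (fun j => (if (i : ℕ) + 1 = j ∨ j + 1 = (i : ℕ) then (1 : ℝ) else 0) * φ j)]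
    have h : ∀ j ∈ Finset.range (K + 1),
        (if (i : ℕ) + 1 = j ∨ j + 1 = (i : ℕ) then (1 : ℝ) else 0) * φ j =
          (if (i : ℕ) + 1 = j then φ j else 0) +
            (if (i : ℕ) - 1 = j then (if 0 < (i : ℕ) then φ j else 0) else 0) := by
      intro j _
      by_cases h1 : (i : ℕ) + 1 = j
      · have h2 : (i : ℕ) - 1 ≠ j := by omega
        simp [h1, h2]
      · by_cases h2 : j + 1 = (i : ℕ)
        · have h3 : (i : ℕ) - 1 = j := by omega
          have h4 : 0 < (i : ℕ) := by omega
          simp [h1, h2, h3, h4]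
        · by_cases h3 : (i : ℕ) - 1 = j
          · have h4 : ¬ 0 < (i : ℕ) := by omega
            simp only [if_neg h4, or_false, h1, h2, if_false]
            simp
          · simp [h1, h2, h3]
    rw [Finset.sum_congr rfl h, Finset.sum_add_distrib, Finset.sum_ite_eq, Finset.sum_ite_eq]
    have h5 : (i : ℕ) - 1 ∈ Finset.range (K + 1) := Finset.mem_range.2 (by omega)
    rw [if_pos h5]
    simp
  · split_ifs <;> simp

theorem wdeg_inr (a : Fin p) : wdeg (broom (K + 1) p) (.inr a) = 1 := by
  have h := sum_adjW_inr (K := K) a (fun _ => 1) (φ := fun _ => 1) (fun _ => rfl)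
  simpa [wdeg] using h

theorem wdeg_inl (i : Fin (K + 1)) : wdeg (broom (K + 1) p) (.inl i) =
    (if (i : ℕ) < K then 1 else 0) + (if 0 < (i : ℕ) then 1 else 0) +
      (if (i : ℕ) = K then (p : ℝ) else 0) := by
  have h := sum_adjW_inl (p := p) i (fun _ => 1) (φ := fun _ => 1) (fun _ => rfl)
  simpa [wdeg] using h

/-- A degree-weighted sum is a sum over edges of the values at both ends; the p pendent edges
contribute p times the centre plus the pendent values. -/
theorem degSum_broom (g : Fin (K + 1) ⊕ Fin p → ℝ) {φ : ℕ → ℝ}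
    (hφ : ∀ i : Fin (K + 1), g (.inl i) = φ i) :
    degSum (broom (K + 1) p) g =
      ∑ l ∈ Finset.range K, (φ l + φ (l + 1)) + p * φ K + ∑ a, g (.inr a) := by
  unfold degSum
  rw [Fintype.sum_sum_type]
  simp only [wdeg_inr, wdeg_inl, hφ, one_mul]
  congr 1
  rw [Fin.sum_univ_eq_sum_range (fun i => ((if i < K then (1 : ℝ) else 0) +
    (if 0 < i then 1 else 0) + (if i = K then (p : ℝ) else 0)) * φ i)]
  simp only [add_mul, Finset.sum_add_distrib]
  congr 1
  · congr 1
    · rw [Finset.sum_range_succ]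
      simp only [lt_irrefl, if_false, zero_mul, add_zero]
      exact Finset.sum_congr rfl fun l hl => by simp [Finset.mem_range.1 hl]
    · rw [Finset.sum_range_succ']
      simp
  · simp

theorem sum_wdeg_broom (K p : ℕ) : ∑ x, wdeg (broom (K + 1) p) x = 2 * (K + p) := by
  have h := degSum_broom (K := K) (p := p) (fun _ => 1) (φ := fun _ => 1) (fun _ => rfl)
  simp only [degSum, mul_one] at h
  rw [h]
  simp
  ring

/-- The distance in the broom, which is its effective resistance. -/
def broomRes (K p : ℕ) : Fin (K + 1) ⊕ Fin p → Fin (K + 1) ⊕ Fin p → ℝ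
  | .inl i, .inl j => |(i : ℝ) - j|
  | .inl i, .inr _ => K - i + 1
  | .inr _, .inl i => K - i + 1
  | .inr a, .inr b => if a = b then 0 else 2

theorem cast_le_of_fin (i : Fin (K + 1)) : ((i : ℕ) : ℝ) ≤ K := by
  exact_mod_cast Nat.lt_succ_iff.1 i.2

theorem broomRes_nonneg (x y : Fin (K + 1) ⊕ Fin p) : 0 ≤ broomRes K p x y := by
  rcases x with i | a <;> rcases y with j | b <;> simp only [broomRes]
  · exact abs_nonneg _
  · linarith [cast_le_of_fin i]
  · linarith [cast_le_of_fin j]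
  · split_ifs <;> norm_num

theorem sum_ite_eq_zero_two (b : Fin p) :
    ∑ a : Fin p, (if a = b then (0 : ℝ) else 2) = 2 * (p - 1) := by
  have h : ∀ a : Fin p, (if a = b then (0 : ℝ) else 2) = 2 - if a = b then 2 else 0 := by
    intro a; split_ifs <;> norm_num
  simp only [h, Finset.sum_sub_distrib, Finset.sum_ite_eq', Finset.mem_univ, if_true]
  simp
  ring

/-- In a tree, exactly one neighbour of x ≠ z is nearer to z and the others are farther, so the
Laplacian of the distance to z is 1 - (deg x - 1). At x = z it is -deg x. -/
theorem isResistance_broomRes (K p : ℕ) : IsResistance (broom (K + 1) p) (broomRes K p)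
    (fun x => 2 - wdeg (broom (K + 1) p) x) := by
  classical
  refine ⟨?_, ?_, ?_⟩
  · rintro (i | a) (j | b) <;> simp only [broomRes]
    · exact abs_sub_comm _ _
    · simp only [eq_comm]
  · rintro (i | a) <;> simp [broomRes]
  · rintro (i | a) (j | b)
    · rw [lap_eq_sub, sum_adjW_inl i _ (φ := fun l => |(l : ℝ) - j|) (fun _ => rfl), wdeg_inl]
      simp only [broomRes, Finset.sum_const, Finset.card_univ, Fintype.card_fin, nsmul_eq_mul]
      have hi := i.2
      have hj := cast_le_of_fin j
      have hij : (Sum.inl i : Fin (K + 1) ⊕ Fin p) = Sum.inl j ↔ (i : ℕ) = j := by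
        rw [Sum.inl.injEq, Fin.ext_iff]
      simp only [hij]
      have hd : 0 < (i : ℕ) → (((i : ℕ) - 1 : ℕ) : ℝ) = (i : ℝ) - 1 := fun h => by
        rw [Nat.cast_sub h]; simp
      have hK : (i : ℕ) = K → ((i : ℕ) : ℝ) = K := fun h => by rw [h]
      rcases lt_trichotomy (i : ℕ) j with h | h | h
      · have h' : (i : ℝ) + 1 ≤ j := by exact_mod_cast h
        rw [abs_of_nonpos (by linarith : (i : ℝ) - j ≤ 0), if_neg h.ne]
        push_cast
        rw [abs_of_nonpos (by linarith : (i : ℝ) + 1 - j ≤ 0)]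
        have : (i : ℕ) < K := by have := j.2; omega
        rw [if_neg this.ne, if_neg this.ne, if_pos this, if_pos this]
        split_ifs with h2
        · rw [hd h2, abs_of_nonpos (by linarith : (i : ℝ) - 1 - j ≤ 0)]
          ring
        · ring
      · have h' : (i : ℝ) = j := by exact_mod_cast h
        rw [if_pos h]
        push_cast
        rw [← h', sub_self, abs_zero]
        have e : |(i : ℝ) + 1 - i| = 1 := by simp
        rw [e]
        split_ifs with h1 h2 h3 h4 h5 h6 <;> first
          | omega
          | (try rw [hd ‹_›]
             try rw [hK ‹_›]
             norm_num
             try ring)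
      · have h' : (j : ℝ) + 1 ≤ i := by exact_mod_cast h
        have hpos : 0 < (i : ℕ) := by omega
        rw [abs_of_nonneg (by linarith : 0 ≤ (i : ℝ) - j), if_neg h.ne']
        push_cast
        rw [abs_of_nonneg (by linarith : 0 ≤ (i : ℝ) + 1 - j), if_pos hpos, if_pos hpos, hd hpos,
          abs_of_nonneg (by linarith : 0 ≤ (i : ℝ) - 1 - j)]
        split_ifs with h1 h2 h3
        · omega
        · ring
        · rw [hK h3]; ring
        · omega
    · rw [lap_eq_sub, sum_adjW_inl i _ (φ := fun l => (K : ℝ) - l + 1) (fun _ => rfl), wdeg_inl]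
      simp only [broomRes, sum_ite_eq_zero_two]
      have hi := i.2
      have hd : 0 < (i : ℕ) → (((i : ℕ) - 1 : ℕ) : ℝ) = (i : ℝ) - 1 := fun h => by
        rw [Nat.cast_sub h]; simp
      have hK : (i : ℕ) = K → ((i : ℕ) : ℝ) = K := fun h => by rw [h]
      rw [if_neg (by simp : ¬ (Sum.inl i : Fin (K + 1) ⊕ Fin p) = Sum.inr b)]
      push_cast
      by_cases h1 : (i : ℕ) < K
      · rw [if_pos h1, if_pos h1, if_neg h1.ne, if_neg h1.ne]
        split_ifs with h2
        · rw [hd h2]; ring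
        · ring
      · have h3 : (i : ℕ) = K := by omega
        rw [if_neg h1, if_neg h1, if_pos h3, if_pos h3]
        split_ifs with h2
        · rw [hd h2, hK h3]; ring
        · have h4 : (K : ℝ) = 0 := by exact_mod_cast (by omega : K = 0)
          rw [hK h3, h4]; ring
    · rw [lap_eq_sub, sum_adjW_inr a _ (φ := fun l => |(l : ℝ) - j|) (fun _ => rfl), wdeg_inr]
      simp only [broomRes]
      rw [abs_of_nonneg (by linarith [cast_le_of_fin j]), if_neg (by simp)]
      ring
    · rw [lap_eq_sub, sum_adjW_inr a _ (φ := fun l => (K : ℝ) - l + 1) (fun _ => rfl), wdeg_inr]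
      simp only [broomRes, Sum.inr.injEq]
      split_ifs <;> ring

theorem degSum_broomRes_inl (j : Fin (K + 1)) :
    degSum (broom (K + 1) p) (fun x => broomRes K p x (.inl j)) =
      (j : ℝ) ^ 2 + (K - j) ^ 2 + 2 * p * (K - j) + p := by
  rw [degSum_broom (K := K) (p := p) (fun x => broomRes K p x (.inl j))
    (φ := fun l => |(l : ℝ) - j|) (fun _ => rfl)]
  obtain ⟨s, hs⟩ := Nat.exists_eq_add_of_le (Nat.lt_succ_iff.1 j.2)
  have hs' : (K : ℝ) = j + s := by exact_mod_cast hs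
  have e : ∑ l ∈ Finset.range K, (|(l : ℝ) - j| + |((l + 1 : ℕ) : ℝ) - j|) =
      (j : ℝ) ^ 2 + (K - j) ^ 2 := by
    nth_rewrite 1 [hs]
    rw [Finset.sum_range_add, sum_range_eq_quadratic (n := j) (2 * j - 1) (-2) 0,
      sum_range_eq_quadratic (n := s) 1 2 0, hs']
    · ring
    · intro l _
      push_cast
      have : (0 : ℝ) ≤ l := Nat.cast_nonneg l
      rw [abs_of_nonneg (by linarith), abs_of_nonneg (by linarith)]
      ring
    · intro l hl
      have : (l : ℝ) + 1 ≤ j := by exact_mod_cast hl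
      push_cast
      rw [abs_of_nonpos (by linarith), abs_of_nonpos (by linarith)]
      ring
  rw [e, abs_of_nonneg (by linarith [cast_le_of_fin j])]
  simp [broomRes]
  ring

theorem degSum_broomRes_inr (a : Fin p) :
    degSum (broom (K + 1) p) (fun x => broomRes K p x (.inr a)) =
      (K : ℝ) ^ 2 + 2 * K + 3 * p - 2 := by
  rw [degSum_broom (K := K) (p := p) (fun x => broomRes K p x (.inr a))
    (φ := fun l => (K : ℝ) - l + 1) (fun _ => rfl),
    sum_range_eq_quadratic (2 * K + 1) (-2) 0 (fun l _ => by push_cast; ring)]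
  simp only [broomRes, sum_ite_eq_zero_two]
  ring

theorem degSum_degSum_broomRes (K p : ℕ) :
    degSum (broom (K + 1) p) (fun x => degSum (broom (K + 1) p) (fun y => broomRes K p x y)) =
      (4 * (K : ℝ) ^ 3 + 2 * K) / 3 + 4 * p * K ^ 2 + 4 * p * K + 4 * p ^ 2 - 2 * p := by
  have hs : (fun x => degSum (broom (K + 1) p) (fun y => broomRes K p x y)) =
      fun x => degSum (broom (K + 1) p) (fun y => broomRes K p y x) :=
    funext fun x => congrArg _ (funext fun y => (isResistance_broomRes K p).symm x y)
  rw [hs, degSum_broom (K := K) (p := p) (fun x => degSum (broom (K + 1) p)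
    (fun y => broomRes K p y x)) (φ := fun j => (j : ℝ) ^ 2 + (K - j) ^ 2 + 2 * p * (K - j) + p)
    (fun j => degSum_broomRes_inl j)]
  simp only [degSum_broomRes_inr]
  rw [sum_range_eq_quadratic (2 * K ^ 2 + 4 * p * K + 2 * p + 2 - 2 * K - 2 * p)
    (4 - 4 * K - 4 * p) 4 (fun l _ => by push_cast; ring)]
  simp
  ring

/-! ### Explicit criteria for the three kinds of pairs -/

theorem mem_braessEdges_broom_iff (hp : 2 ≤ p) {u v : Fin (K + 1) ⊕ Fin p} (huv : u ≠ v)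
    (hadj : ¬ (broom (K + 1) p).Adj u v) :
    s(u, v) ∈ braessEdges (broom (K + 1) p) ↔
      (4 * (K : ℝ) ^ 3 + 2 * K) / 3 + 4 * p * K ^ 2 + 4 * p * K + 4 * p ^ 2 - 2 * p <
        (K + p) *
        (2 * (degSum (broom (K + 1) p) (fun x => broomRes K p x u) +
          degSum (broom (K + 1) p) (fun x => broomRes K p x v)) + 2 * broomRes K p u v -
          (2 * (K + p + 1) * (degSum (broom (K + 1) p)
            (fun x => (broomRes K p x u - broomRes K p x v) ^ 2) + 2 * broomRes K p u v ^ 2) -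
            degSum (broom (K + 1) p) (fun x => broomRes K p x u - broomRes K p x v) ^ 2) /
              (2 * (1 + broomRes K p u v))) := by
  have hp' : (2 : ℝ) ≤ p := by exact_mod_cast hp
  rw [mem_braessEdges_iff (broom_connected K p) (isResistance_broomRes K p) broomRes_nonneg
    (by rw [sum_wdeg_broom]; positivity) huv hadj, degSum_degSum_broomRes, sum_wdeg_broom]
  rw [show 2 * ((K : ℝ) + p) + 2 = 2 * (K + p + 1) by ring, mul_assoc 2 ((K : ℝ) + p)]
  exact mul_lt_mul_iff_right₀ two_pos

theorem sum_ite_eq_else (a : Fin p) (c d : ℝ) :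
    ∑ x : Fin p, (if x = a then c else d) = c + (p - 1) * d := by
  have h : ∀ x : Fin p, (if x = a then c else d) = d + if x = a then c - d else 0 := by
    intro x; split_ifs <;> ring
  simp only [h, Finset.sum_add_distrib, Finset.sum_ite_eq', Finset.mem_univ, if_true]
  simp
  ring

/-- Only the two chosen pendent vertices distinguish them from each other, with opposite values ±2,
so the linear sum vanishes. The polynomial is the criterion multiplied by 3. -/
theorem star_mem_braessEdges_iff (hp : 2 ≤ p) {a b : Fin p} (hab : a ≠ b) :
    s(Sum.inr a, Sum.inr b) ∈ braessEdges (broom (K + 1) p) ↔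
      0 < 8 * (K : ℝ) ^ 3 + 8 * K ^ 2 - 30 * K + 16 * p * K + 8 * p ^ 2 - 22 * p := by
  rw [mem_braessEdges_broom_iff hp (by simpa using hab) (broom_adj_inr_inr a b)]
  simp only [degSum_broomRes_inr]
  have e : ∀ x : Fin p, broomRes K p (.inr x) (.inr a) - broomRes K p (.inr x) (.inr b) =
      (if x = b then 2 else 0) - (if x = a then 2 else 0) := by
    intro x
    simp only [broomRes]
    split_ifs <;> norm_num
  have e2 : ∀ x : Fin p, (broomRes K p (.inr x) (.inr a) - broomRes K p (.inr x) (.inr b)) ^ 2 =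
      (if x = b then 4 else 0) + (if x = a then 4 else 0) := by
    intro x
    rw [e]
    split_ifs with h1 h2
    · exact absurd (h2.symm.trans h1) hab
    all_goals norm_num
  have f1 : degSum (broom (K + 1) p)
      (fun x => broomRes K p x (.inr a) - broomRes K p x (.inr b)) = 0 := by
    rw [degSum_broom (K := K) (p := p) _ (φ := fun _ => 0) (fun _ => sub_self _)]
    simp only [e, Finset.sum_sub_distrib]
    simp
  have f2 : degSum (broom (K + 1) p)
      (fun x => (broomRes K p x (.inr a) - broomRes K p x (.inr b)) ^ 2) = 8 := by
    rw [degSum_broom (K := K) (p := p) _ (φ := fun _ => 0) (fun i => by simp [broomRes])]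
    simp only [e2, Finset.sum_add_distrib]
    simp
    norm_num
  rw [f1, f2]
  simp only [broomRes, if_neg hab]
  ring_nf
  constructor <;> intro h <;> linarith

/-- The difference of distances is -r before i, r from j on (pendent vertices included), and linear
between. The combination (D + 2)∑f² - (∑f)² thereby produces the product of the masses `p + s` and
`b` on the two sides; `r + 1` is the length of the new cycle. -/
theorem path_mem_braessEdges_iff (hp : 2 ≤ p) {b r s : ℕ} (hK : K = b + r + s) (hr : 2 ≤ r)
    {i j : Fin (K + 1)} (hi : (i : ℕ) = b) (hj : (j : ℕ) = b + r) :
    s(Sum.inl i, Sum.inl j) ∈ braessEdges (broom (K + 1) p) ↔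
      (4 * (K : ℝ) ^ 3 + 2 * K) / 3 + 4 * p * K ^ 2 + 4 * p * K + 4 * p ^ 2 - 2 * p <
        (K + p) * (2 * ((b : ℝ) ^ 2 + (r + s) ^ 2 + 2 * p * (r + s) + p +
          ((b + r : ℝ) ^ 2 + s ^ 2 + 2 * p * s + p)) + 2 * r -
          (8 * (r : ℝ) ^ 2 * (p + s) * b / (r + 1) + 4 * r * (2 * r + 1) * (p + s + b) / 3 +
            2 * r * (r + 1) * (r + 2) / 3)) := by
  have hi' : (i : ℝ) = b := by exact_mod_cast hi
  have hj' : (j : ℝ) = b + r := by exact_mod_cast hj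
  have hK' : (K : ℝ) = b + r + s := by exact_mod_cast hK
  have hr0 : (0 : ℝ) ≤ r := Nat.cast_nonneg r
  rw [mem_braessEdges_broom_iff hp
    (by rw [Ne, Sum.inl.injEq, Fin.ext_iff]; omega)
    (by rw [broom_adj_inl_inl]; omega)]
  simp only [degSum_broomRes_inl]
  have e0 : broomRes K p (.inl i) (.inl j) = r := by
    simp only [broomRes]
    rw [hi', hj', abs_of_nonpos (by linarith)]; ring
  have lo : ∀ l : ℕ, l ≤ b → |(l : ℝ) - b| - |(l : ℝ) - (b + r)| = -r := by
    intro l hl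
    have : (l : ℝ) ≤ b := by exact_mod_cast hl
    rw [abs_of_nonpos (by linarith), abs_of_nonpos (by linarith)]; ring
  have mid : ∀ l : ℕ, l ≤ r → |((b + l : ℕ) : ℝ) - b| - |((b + l : ℕ) : ℝ) - (b + r)| =
      2 * l - r := by
    intro l hl
    have : (l : ℝ) ≤ r := by exact_mod_cast hl
    have : (0 : ℝ) ≤ l := Nat.cast_nonneg l
    push_cast
    rw [abs_of_nonneg (by linarith), abs_of_nonpos (by linarith)]; ring
  have hi : ∀ l : ℕ, |((b + r + l : ℕ) : ℝ) - b| - |((b + r + l : ℕ) : ℝ) - (b + r)| = r := by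
    intro l
    have : (0 : ℝ) ≤ l := Nat.cast_nonneg l
    push_cast
    rw [abs_of_nonneg (by linarith), abs_of_nonneg (by linarith)]; ring
  have hiK : |(K : ℝ) - b| - |(K : ℝ) - (b + r)| = r := by
    have := hi s
    rwa [← hK] at this
  have e1 : degSum (broom (K + 1) p)
      (fun x => broomRes K p x (.inl i) - broomRes K p x (.inl j)) =
        2 * r * (s + p) - 2 * r * b := by
    rw [degSum_broom (K := K) (p := p) _ (φ := fun l => |(l : ℝ) - b| - |(l : ℝ) - (b + r)|)
      (fun l => by simp only [broomRes, hi', hj'])]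
    have : ∑ l ∈ Finset.range K, ((|(l : ℝ) - b| - |(l : ℝ) - (b + r)|) +
        (|((l + 1 : ℕ) : ℝ) - b| - |((l + 1 : ℕ) : ℝ) - (b + r)|)) = 2 * r * s - 2 * r * b := by
      nth_rewrite 1 [hK]
      rw [Finset.sum_range_add, Finset.sum_range_add,
        sum_range_eq_quadratic (n := b) (-2 * r) 0 0,
        sum_range_eq_quadratic (n := r) (2 - 2 * r) 4 0,
        sum_range_eq_quadratic (n := s) (2 * r) 0 0]
      · ring
      · intro l _
        rw [hi, add_assoc (b + r) l 1, hi]; ring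
      · intro l hl
        rw [mid l hl.le, add_assoc b l 1, mid _ hl]; push_cast; ring
      · intro l hl
        rw [lo l hl.le, lo _ hl]; ring
    rw [this, hiK]
    simp only [broomRes, hi', hj', Finset.sum_const, Finset.card_univ, Fintype.card_fin,
      nsmul_eq_mul]
    ring
  have e2 : degSum (broom (K + 1) p)
      (fun x => (broomRes K p x (.inl i) - broomRes K p x (.inl j)) ^ 2) =
        2 * r ^ 2 * (s + p + b) + (2 * r ^ 3 + 4 * r) / 3 := by
    rw [degSum_broom (K := K) (p := p) _
      (φ := fun l => (|(l : ℝ) - b| - |(l : ℝ) - (b + r)|) ^ 2)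
      (fun l => by simp only [broomRes, hi', hj'])]
    have : ∑ l ∈ Finset.range K, ((|(l : ℝ) - b| - |(l : ℝ) - (b + r)|) ^ 2 +
        (|((l + 1 : ℕ) : ℝ) - b| - |((l + 1 : ℕ) : ℝ) - (b + r)|) ^ 2) =
          2 * r ^ 2 * (s + b) + (2 * r ^ 3 + 4 * r) / 3 := by
      nth_rewrite 1 [hK]
      rw [Finset.sum_range_add, Finset.sum_range_add,
        sum_range_eq_quadratic (n := b) (2 * r ^ 2) 0 0,
        sum_range_eq_quadratic (n := r) (r ^ 2 + (2 - r) ^ 2) (8 - 8 * r) 8,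
        sum_range_eq_quadratic (n := s) (2 * r ^ 2) 0 0]
      · ring
      · intro l _
        rw [hi, add_assoc (b + r) l 1, hi]; ring
      · intro l hl
        rw [mid l hl.le, add_assoc b l 1, mid _ hl]; push_cast; ring
      · intro l hl
        rw [lo l hl.le, lo _ hl]; ring
    rw [this, hiK]
    simp only [broomRes, hi', hj', Finset.sum_const, Finset.card_univ, Fintype.card_fin,
      nsmul_eq_mul]
    ring
  rw [e0, e1, e2, hi', hj', hK']
  have hne : (r : ℝ) + 1 ≠ 0 := by positivity
  have hne' : 1 + (r : ℝ) ≠ 0 := by positivity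
  refine iff_of_eq (congrArg _ (congrArg _ ?_))
  field_simp
  ring

/-- Here t is the distance from the path vertex to the centre. The other p - 1 pendent vertices see
the difference t - 1, and the new cycle has length t + 2. The loss is grouped by p - 1 and b to
expose its growth in p. -/
theorem mixed_mem_braessEdges_iff (hp : 2 ≤ p) {b t : ℕ} (hK : K = b + t) (ht : 1 ≤ t)
    {i : Fin (K + 1)} (hi : (i : ℕ) = b) (a : Fin p) :
    s(Sum.inl i, Sum.inr a) ∈ braessEdges (broom (K + 1) p) ↔
      (4 * (K : ℝ) ^ 3 + 2 * K) / 3 + 4 * p * K ^ 2 + 4 * p * K + 4 * p ^ 2 - 2 * p <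
        (K + p) * (2 * ((b : ℝ) ^ 2 + t ^ 2 + 2 * p * t + p + (K ^ 2 + 2 * K + 3 * p - 2)) +
          2 * (t + 1) - (2 / (t + 2)) * (4 * (t : ℝ) ^ 2 * (p - 1) * b +
            (p - 1) * ((t - 1 : ℝ) ^ 2 * (t + 2) + ((t + 1 : ℝ) ^ 3 + 2 * (t + 1)) / 3 +
              (t + 1) ^ 2) +
            b * ((t + 1 : ℝ) ^ 2 * (t + 2) + ((t + 1 : ℝ) ^ 3 + 2 * (t + 1)) / 3 + (t + 1) ^ 2) +
            (t + 2) * (((t + 1 : ℝ) ^ 3 + 2 * (t + 1)) / 3 + (t + 1) ^ 2))) := by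
  have hi' : (i : ℝ) = b := by exact_mod_cast hi
  have hK' : (K : ℝ) = b + t := by exact_mod_cast hK
  have ht0 : (0 : ℝ) ≤ t := Nat.cast_nonneg t
  rw [mem_braessEdges_broom_iff hp (by simp) (by rw [broom_adj_inl_inr]; omega)]
  rw [degSum_broomRes_inl, degSum_broomRes_inr]
  have e0 : broomRes K p (.inl i) (.inr a) = t + 1 := by
    simp only [broomRes]
    rw [hi', hK']; ring
  have lo : ∀ l : ℕ, l ≤ b → |(l : ℝ) - b| - (K - l + 1) = -(t + 1) := by
    intro l hl
    have : (l : ℝ) ≤ b := by exact_mod_cast hl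
    rw [abs_of_nonpos (by linarith), hK']; ring
  have mid : ∀ l : ℕ, |((b + l : ℕ) : ℝ) - b| - (K - (b + l : ℕ) + 1) = 2 * l - t - 1 := by
    intro l
    have : (0 : ℝ) ≤ l := Nat.cast_nonneg l
    push_cast
    rw [abs_of_nonneg (by linarith), hK']; ring
  have hiK : |(K : ℝ) - b| - (K - K + 1) = t - 1 := by
    rw [hK', abs_of_nonneg (by linarith)]; ring
  have ep : ∀ x : Fin p, broomRes K p (.inr x) (.inl i) - broomRes K p (.inr x) (.inr a) =
      if x = a then (t + 1 : ℝ) else t - 1 := by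
    intro x
    simp only [broomRes, hi', hK']
    split_ifs <;> ring
  have ep2 : ∀ x : Fin p, (broomRes K p (.inr x) (.inl i) - broomRes K p (.inr x) (.inr a)) ^ 2 =
      if x = a then (t + 1 : ℝ) ^ 2 else (t - 1) ^ 2 := by
    intro x
    rw [ep]
    split_ifs <;> ring
  have e1 : degSum (broom (K + 1) p)
      (fun x => broomRes K p x (.inl i) - broomRes K p x (.inr a)) =
        2 * (p - 1) * (t - 1) - 2 * (t + 1) * b := by
    rw [degSum_broom (K := K) (p := p) _ (φ := fun l => |(l : ℝ) - b| - (K - l + 1))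
      (fun l => by simp only [broomRes, hi'])]
    have : ∑ l ∈ Finset.range K, ((|(l : ℝ) - b| - (K - l + 1)) +
        (|((l + 1 : ℕ) : ℝ) - b| - (K - (l + 1 : ℕ) + 1))) = -2 * (t + 1) * b - 2 * t := by
      nth_rewrite 1 [hK]
      rw [Finset.sum_range_add,
        sum_range_eq_quadratic (n := b) (-2 * (t + 1)) 0 0,
        sum_range_eq_quadratic (n := t) (-2 * t) 4 0]
      · ring
      · intro l _
        rw [mid l, add_assoc b l 1, mid]; push_cast; ring
      · intro l hl
        rw [lo l hl.le, lo _ hl]; ring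
    rw [this, hiK]
    simp only [ep, sum_ite_eq_else]
    ring
  have e2 : degSum (broom (K + 1) p)
      (fun x => (broomRes K p x (.inl i) - broomRes K p x (.inr a)) ^ 2) =
        2 * (p - 1) * (t - 1) ^ 2 + 2 * (t + 1) ^ 2 * b +
          (2 * (t + 1 : ℝ) ^ 3 + 4 * (t + 1)) / 3 := by
    rw [degSum_broom (K := K) (p := p) _ (φ := fun l => (|(l : ℝ) - b| - (K - l + 1)) ^ 2)
      (fun l => by simp only [broomRes, hi'])]
    have : ∑ l ∈ Finset.range K, ((|(l : ℝ) - b| - (K - l + 1)) ^ 2 +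
        (|((l + 1 : ℕ) : ℝ) - b| - (K - (l + 1 : ℕ) + 1)) ^ 2) =
          2 * (t + 1) ^ 2 * b + (2 * (t + 1 : ℝ) ^ 3 + 4 * (t + 1)) / 3
            - (t - 1) ^ 2 - (t + 1) ^ 2 := by
      nth_rewrite 1 [hK]
      rw [Finset.sum_range_add,
        sum_range_eq_quadratic (n := b) (2 * (t + 1) ^ 2) 0 0,
        sum_range_eq_quadratic (n := t) ((t + 1) ^ 2 + (t - 1) ^ 2) (-8 * t) 8]
      · ring
      · intro l _
        rw [mid l, add_assoc b l 1, mid]; push_cast; ring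
      · intro l hl
        rw [lo l hl.le, lo _ hl]; ring
    rw [this, hiK]
    simp only [ep2, sum_ite_eq_else]
    ring
  rw [e0, e1, e2, hi', hK']
  have hne : (t : ℝ) + 2 ≠ 0 := by positivity
  have hne' : 1 + ((t : ℝ) + 1) ≠ 0 := by positivity
  refine iff_of_eq (congrArg _ (congrArg _ ?_))
  field_simp
  ring

end Broom

/-! ### Inequalities between gain and loss -/

section Inequalities

/-- Divided by t + 2, the right side is the coefficient of p - 1 in the loss of the mixed criterion.
It must beat 4(t + 1), which nearly matches the growth 4t + 8 of the gain in p, with a surplus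
linear in b + t. Equality holds at t = 1, b = 2; the cases with b + t = 2 fail. -/
theorem mixed_weight_lower {b t : ℝ} (hb : 0 ≤ b)
    (h : (t = 1 ∧ 2 ≤ b) ∨ (t = 2 ∧ 1 ≤ b) ∨ 3 ≤ t) :
    (4 * (t + 1) + 8 / 9 * (b + t)) * (t + 2) ≤ 2 * (4 * t ^ 2 * b + (t - 1) ^ 2 * (t + 2) +
      ((t + 1) ^ 3 + 2 * (t + 1)) / 3 + (t + 1) ^ 2) := by
  rcases h with ⟨rfl, h⟩ | ⟨rfl, h⟩ | h
  · linarith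
  · linarith
  · obtain ⟨x, rfl⟩ : ∃ x, t = 3 + x := ⟨t - 3, by ring⟩
    have hx : 0 ≤ x := by linarith
    have : 0 ≤ b * x := mul_nonneg hb hx
    have : 0 ≤ b * x ^ 2 := mul_nonneg hb (sq_nonneg x)
    have : 0 ≤ x ^ 3 := pow_nonneg hx 3
    linarith [sq_nonneg x]

theorem mixed_weight_lower_mul {b t : ℝ} (hb : 0 ≤ b) (ht : 1 ≤ t) :
    8 / 27 * (t + 1) * (b + t) * (t + 2) ≤ 2 * (4 * t ^ 2 * b + (t - 1) ^ 2 * (t + 2) +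
      ((t + 1) ^ 3 + 2 * (t + 1)) / 3 + (t + 1) ^ 2) := by
  obtain ⟨x, rfl⟩ : ∃ x, t = 1 + x := ⟨t - 1, by ring⟩
  have hx : 0 ≤ x := by linarith
  have : 0 ≤ b * x := mul_nonneg hb hx
  have : 0 ≤ b * x ^ 2 := mul_nonneg hb (sq_nonneg x)
  have : 0 ≤ x ^ 3 := pow_nonneg hx 3
  linarith [sq_nonneg x]

theorem sq_add_sq_le_sq_add {x y : ℝ} (hx : 0 ≤ x) (hy : 0 ≤ y) :
    x ^ 2 + y ^ 2 ≤ (x + y) ^ 2 := by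
  linarith [mul_nonneg hx hy]

theorem mul_le_of_mixed {K p b t : ℝ} (hK : K = b + t) (hb : 0 ≤ b) (ht : 1 ≤ t)
    (h : (t = 1 ∧ 2 ≤ b) ∨ (t = 2 ∧ 1 ≤ b) ∨ 3 ≤ t) (hp : 2 ≤ p)
    (hlt : (4 * K ^ 3 + 2 * K) / 3 + 4 * p * K ^ 2 + 4 * p * K + 4 * p ^ 2 - 2 * p <
        (K + p) * (2 * (b ^ 2 + t ^ 2 + 2 * p * t + p + (K ^ 2 + 2 * K + 3 * p - 2)) +
          2 * (t + 1) - (2 / (t + 2)) * (4 * t ^ 2 * (p - 1) * b +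
            (p - 1) * ((t - 1) ^ 2 * (t + 2) + ((t + 1) ^ 3 + 2 * (t + 1)) / 3 + (t + 1) ^ 2) +
            b * ((t + 1) ^ 2 * (t + 2) + ((t + 1) ^ 3 + 2 * (t + 1)) / 3 + (t + 1) ^ 2) +
            (t + 2) * (((t + 1) ^ 3 + 2 * (t + 1)) / 3 + (t + 1) ^ 2)))) :
    p * (t + 1) ≤ 959 * K := by
  have hK3 : 3 ≤ K := by rcases h with h | h | h <;> linarith
  set Γ := 4 * t ^ 2 * b + (t - 1) ^ 2 * (t + 2) + ((t + 1) ^ 3 + 2 * (t + 1)) / 3 + (t + 1) ^ 2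
    with hΓ
  set Θ := b * ((t + 1) ^ 2 * (t + 2) + ((t + 1) ^ 3 + 2 * (t + 1)) / 3 + (t + 1) ^ 2) +
            (t + 2) * (((t + 1) ^ 3 + 2 * (t + 1)) / 3 + (t + 1) ^ 2) with hΘ
  set γ := 2 / (t + 2) * Γ with hγ
  set X := 2 * (b ^ 2 + t ^ 2 + 2 * p * t + p + (K ^ 2 + 2 * K + 3 * p - 2)) + 2 * (t + 1) with hX
  have hΘ0 : 0 ≤ 2 / (t + 2) * Θ := by positivity
  have hm : 0 < K + p := by linarith
  have h1 : (4 * K ^ 3 + 2 * K) / 3 + 4 * p * K ^ 2 + 4 * p * K + 4 * p ^ 2 - 2 * p <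
      (K + p) * (X - (p - 1) * γ) := by
    refine hlt.trans_le (mul_le_mul_of_nonneg_left ?_ hm.le)
    have : (2 / (t + 2)) * (4 * t ^ 2 * (p - 1) * b +
            (p - 1) * ((t - 1) ^ 2 * (t + 2) + ((t + 1) ^ 3 + 2 * (t + 1)) / 3 + (t + 1) ^ 2) +
            b * ((t + 1) ^ 2 * (t + 2) + ((t + 1) ^ 3 + 2 * (t + 1)) / 3 + (t + 1) ^ 2) +
            (t + 2) * (((t + 1) ^ 3 + 2 * (t + 1)) / 3 + (t + 1) ^ 2)) =
          (p - 1) * γ + 2 / (t + 2) * Θ := by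
      rw [hγ, hΓ, hΘ]; ring
    rw [this]
    linarith
  have hbt : b ^ 2 + t ^ 2 ≤ K ^ 2 := by
    rw [hK]; exact sq_add_sq_le_sq_add hb (by linarith)
  have hγ' : γ = 2 * Γ / (t + 2) := by rw [hγ]; ring
  have htK : t ≤ K := by linarith
  -- For p > 17K the surplus, of order -K p², outweighs the remaining 8K²(K + p), so there is no
  -- Braess edge.
  rcases lt_or_ge (17 * K) p with hpK | hpK
  · exfalso
    have hg : 4 * (t + 1) + 8 / 9 * K ≤ γ := by
      rw [hγ', le_div_iff₀ (by linarith), hΓ, hK]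
      exact mixed_weight_lower hb h
    have h2 : X - (p - 1) * γ ≤ 4 * p - 8 / 9 * K * (p - 1) + 8 * K ^ 2 := by
      have := mul_le_mul_of_nonneg_left hg (by linarith : 0 ≤ p - 1)
      have : 0 ≤ (K - 3) * K := mul_nonneg (by linarith) (by linarith)
      rw [hX]
      linarith
    have h3 := h1.trans_le (mul_le_mul_of_nonneg_left h2 hm.le)
    have h4 : 0 < (p - 17 * K) * K ^ 2 := mul_pos (by linarith) (by positivity)
    have h5 : 0 < (p - 17 * K) * (K * p) :=
      mul_pos (by linarith) (mul_pos (by linarith) (by linarith))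
    have h6 : 0 ≤ (K - 3) * (K * p) := mul_nonneg (by linarith)
      (mul_nonneg (by linarith) (by linarith))
    have h7 : 0 ≤ (K - 3) * p := mul_nonneg (by linarith) (by linarith)
    have h8 : 0 ≤ (p - 2) * K ^ 2 := mul_nonneg (by linarith) (by positivity)
    have h9 : 0 < K * p := mul_pos (by linarith) (by linarith)
    have h10 : 0 < K ^ 3 := pow_pos (by linarith) 3
    linarith
  · have hA : 0 ≤ (4 * K ^ 3 + 2 * K) / 3 + 4 * p * K ^ 2 + 4 * p * K + 4 * p ^ 2 - 2 * p := by
      have : 0 ≤ (4 * K ^ 3 + 2 * K) / 3 + 4 * p * K ^ 2 + 4 * p * K := by positivity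
      have : 0 ≤ (p - 2) * p := mul_nonneg (by linarith) (by linarith)
      linarith [sq_nonneg p]
    have h2 : 0 < X - (p - 1) * γ := pos_of_mul_pos_right (hA.trans_lt h1) hm.le
    have h3 : X ≤ 142 * K ^ 2 := by
      have : p * t ≤ p * K := mul_le_mul_of_nonneg_left htK (by linarith)
      have : p * K ≤ 17 * K * K := mul_le_mul_of_nonneg_right hpK (by linarith)
      have : 0 ≤ (K - 3) * K := mul_nonneg (by linarith) (by linarith)
      rw [hX]
      linarith
    have hg : 8 / 27 * (t + 1) * K ≤ γ := by
      rw [hγ', le_div_iff₀ (by linarith), hΓ, hK]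
      exact mixed_weight_lower_mul hb ht
    -- The loss must stay below the gain. Since 142 · 27 / 4 = 958.5, this yields the constant 959.
    have h4 : p / 2 * (8 / 27 * (t + 1) * K) ≤ 142 * K ^ 2 := by
      have := mul_le_mul (by linarith : p / 2 ≤ p - 1) hg (by positivity) (by linarith)
      linarith
    have h5 : K * (p * (t + 1)) ≤ K * (959 * K) := by linarith [sq_nonneg K]
    exact le_of_mul_le_mul_left h5 (by linarith)

theorem path_upper {K p b r s : ℝ} (hK : K = b + r + s) (hb : 0 ≤ b) (hr : 1 ≤ r) (hs : 0 ≤ s)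
    (hp : 2 ≤ p) (hK72 : 72 ≤ K)
    (hlt : (4 * K ^ 3 + 2 * K) / 3 + 4 * p * K ^ 2 + 4 * p * K + 4 * p ^ 2 - 2 * p <
        (K + p) * (2 * (b ^ 2 + (r + s) ^ 2 + 2 * p * (r + s) + p +
          ((b + r) ^ 2 + s ^ 2 + 2 * p * s + p)) + 2 * r -
          (8 * r ^ 2 * (p + s) * b / (r + 1) + 4 * r * (2 * r + 1) * (p + s + b) / 3 +
            2 * r * (r + 1) * (r + 2) / 3))) :
    r * b < 12 * K ∨ r * s < 12 * K := by
  by_contra! hcon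
  obtain ⟨h1, h2⟩ := hcon
  have hm : 0 < K + p := by linarith
  have hA : 0 ≤ (4 * K ^ 3 + 2 * K) / 3 + 4 * p * K ^ 2 + 4 * p * K + 4 * p ^ 2 - 2 * p := by
    have : 0 ≤ (4 * K ^ 3 + 2 * K) / 3 + 4 * p * K ^ 2 + 4 * p * K := by positivity
    have : 0 ≤ (p - 2) * p := mul_nonneg (by linarith) (by linarith)
    linarith [sq_nonneg p]
  have h3 := pos_of_mul_pos_right (hA.trans_lt hlt) hm.le
  have h4 : 4 * r * ((p + s) * b) ≤ 8 * r ^ 2 * (p + s) * b / (r + 1) := by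
    rw [le_div_iff₀ (by linarith)]
    have : 0 ≤ (r - 1) * (r * ((p + s) * b)) := mul_nonneg (by linarith) (by positivity)
    linarith
  have h5 : 2 / 3 * r ^ 2 * (K + p) ≤ 4 * r * (2 * r + 1) * (p + s + b) / 3 +
            2 * r * (r + 1) * (r + 2) / 3 := by
    have : 0 ≤ r * (p + s + b) := by positivity
    have : 0 ≤ r ^ 2 * (p + s + b) := by positivity
    rw [hK]
    linarith [sq_nonneg r]
  have h6 : 2 * (b ^ 2 + (r + s) ^ 2 + 2 * p * (r + s) + p +
          ((b + r) ^ 2 + s ^ 2 + 2 * p * s + p)) + 2 * r ≤ 12 * K * (K + p) := by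
    have e1 : b ^ 2 + (r + s) ^ 2 ≤ K ^ 2 := by
      rw [hK, add_assoc]; exact sq_add_sq_le_sq_add hb (by linarith)
    have e2 : (b + r) ^ 2 + s ^ 2 ≤ K ^ 2 := by
      rw [hK]; exact sq_add_sq_le_sq_add (by linarith) hs
    have e3 : p * (r + s) ≤ p * K := mul_le_mul_of_nonneg_left (by linarith) (by linarith)
    have e4 : p * s ≤ p * K := mul_le_mul_of_nonneg_left (by linarith) (by linarith)
    have e5 : 0 ≤ (K - 72) * K := mul_nonneg (by linarith) (by linarith)
    have e6 : 0 ≤ (K - 72) * p := mul_nonneg (by linarith) (by linarith)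
    linarith
  have h7 : 0 ≤ 4 * r * ((p + s) * b) := by positivity
  -- The part of the loss quadratic in r alone bounds r by O(√K), hence by K/2, so p + s + b is at
  -- least half of K + p.
  have h8 : 2 / 3 * r ^ 2 < 12 * K := by
    have : 2 / 3 * r ^ 2 * (K + p) < 12 * K * (K + p) := by linarith
    exact lt_of_mul_lt_mul_right this hm.le
  have h9 : r < K / 2 := by
    by_contra! h
    have : (K / 2) ^ 2 ≤ r ^ 2 := pow_le_pow_left₀ (by linarith) h 2
    have : 0 ≤ (K - 72) * K := mul_nonneg (by linarith) (by linarith)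
    linarith
  have h10 : 0 ≤ 2 / 3 * r ^ 2 * (K + p) := by positivity
  have h11 : 12 * K ≤ r * (p + s) := by
    have : 0 ≤ r * p := by positivity
    linarith
  -- Half of the product loss 4r(p + s)b is bounded through r(p + s) ≥ 12K, the other half through r
  -- b ≥ 12K. Together they exceed the whole gain.
  have h12 : 12 * K * b ≤ r * (p + s) * b := mul_le_mul_of_nonneg_right h11 hb
  have h13 : 12 * K * (p + s) ≤ r * b * (p + s) :=
    mul_le_mul_of_nonneg_right h1 (by linarith)
  have h14 : 12 * K * (K + p) ≤ 24 * K * (p + s + b) := by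
    have : K * (K + p) ≤ K * (2 * (p + s + b)) :=
      mul_le_mul_of_nonneg_left (by linarith) (by linarith)
    linarith
  linarith

/-- Both vertices lie near the free end of the path, so s ≥ 15K/16 and the gain is close to its
maximum, while the loss is at most (1/2 + 1/4) K (K + p). -/
theorem path_lower {K p b r s : ℝ} (hK : K = b + r + s) (hb : 0 ≤ b) (hr : 2 ≤ r)
    (hp : 2 ≤ p) (h1 : 16 * (r * b) ≤ K) (h2 : 16 * r ^ 2 ≤ K) :
    (4 * K ^ 3 + 2 * K) / 3 + 4 * p * K ^ 2 + 4 * p * K + 4 * p ^ 2 - 2 * p <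
        (K + p) * (2 * (b ^ 2 + (r + s) ^ 2 + 2 * p * (r + s) + p +
          ((b + r) ^ 2 + s ^ 2 + 2 * p * s + p)) + 2 * r -
          (8 * r ^ 2 * (p + s) * b / (r + 1) + 4 * r * (2 * r + 1) * (p + s + b) / 3 +
            2 * r * (r + 1) * (r + 2) / 3)) := by
  have hK64 : 64 ≤ K := by nlinarith
  have hbK : b ≤ K / 32 := by nlinarith
  have hrK : r ≤ K / 32 := by nlinarith
  have hs : 15 / 16 * K ≤ s := by linarith
  have hs0 : 0 ≤ s := by linarith
  have hm : 0 < K + p := by linarith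
  have q1 : 8 * r ^ 2 * (p + s) * b / (r + 1) ≤ 8 * (r * b) * (p + s) := by
    rw [div_le_iff₀ (by linarith)]
    have : 0 ≤ r * b * (p + s) := by positivity
    linarith
  have q2 : 4 * r * (2 * r + 1) * (p + s + b) / 3 + 2 * r * (r + 1) * (r + 2) / 3 ≤
      4 * r ^ 2 * (K + p) := by
    have : 0 ≤ (r - 1) * (r * (p + s + b)) := mul_nonneg (by linarith) (by positivity)
    have : 0 ≤ (r - 2) * r := mul_nonneg (by linarith) (by linarith)
    have : 0 ≤ (r - 2) * r ^ 2 := mul_nonneg (by linarith) (by positivity)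
    rw [hK]
    linarith
  have q3 : 8 * (r * b) * (p + s) ≤ K / 2 * (K + p) :=
    mul_le_mul (by linarith) (by linarith) (by linarith) (by linarith)
  have q4 : 4 * r ^ 2 * (K + p) ≤ K / 4 * (K + p) :=
    mul_le_mul_of_nonneg_right (by linarith) hm.le
  have x1 : (15 / 16 * K) ^ 2 ≤ s ^ 2 := pow_le_pow_left₀ (by linarith) hs 2
  have x2 : (15 / 16 * K) ^ 2 ≤ (r + s) ^ 2 := pow_le_pow_left₀ (by linarith) (by linarith) 2
  have x3 : p * (15 / 16 * K) ≤ p * s := mul_le_mul_of_nonneg_left hs (by linarith)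
  have x4 : 0 ≤ p * r := by positivity
  have h3 : 11 / 4 * K ^ 2 + 27 / 4 * p * K ≤ 2 * (b ^ 2 + (r + s) ^ 2 + 2 * p * (r + s) + p +
          ((b + r) ^ 2 + s ^ 2 + 2 * p * s + p)) + 2 * r -
          (8 * r ^ 2 * (p + s) * b / (r + 1) + 4 * r * (2 * r + 1) * (p + s + b) / 3 +
            2 * r * (r + 1) * (r + 2) / 3) := by
    linarith [sq_nonneg b, sq_nonneg (b + r), sq_nonneg K]
  refine lt_of_lt_of_le ?_ (mul_le_mul_of_nonneg_left h3 hm.le)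
  have y1 : 0 ≤ (K - 64) * K := mul_nonneg (by linarith) (by linarith)
  have y2 : 0 ≤ (K - 64) * K * p := mul_nonneg y1 (by linarith)
  have y3 : 0 ≤ (K - 64) * K * K := mul_nonneg y1 (by linarith)
  have y4 : 0 ≤ (K - 64) * p ^ 2 := mul_nonneg (by linarith) (by positivity)
  have y5 : 0 ≤ (K - 64) * p := mul_nonneg (by linarith) (by linarith)
  have y6 : 0 ≤ (p - 2) * p := mul_nonneg (by linarith) (by linarith)
  linarith

end Inequalities

/-! ### Counting Braess edges -/

section Counting

theorem star_mem_braessEdges {K p : ℕ} (hp : 2 ≤ p) (h4 : 4 ≤ K + 1 + p) {a b : Fin p}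
    (hab : a ≠ b) : s(Sum.inr a, Sum.inr b) ∈ braessEdges (broom (K + 1) p) := by
  rw [star_mem_braessEdges_iff hp hab]
  have hp' : (2 : ℝ) ≤ p := by exact_mod_cast hp
  rcases Nat.eq_zero_or_pos K with h | h
  -- For K = 0 the polynomial is 8p² - 22p, which is negative at p = 2; this is where k + p ≥ 4 is
  -- needed.
  · have : (3 : ℝ) ≤ p := by exact_mod_cast (by omega : 3 ≤ p)
    subst h
    norm_num
    nlinarith
  · have hK : (1 : ℝ) ≤ K := by exact_mod_cast h
    have h1 : (1 : ℝ) ≤ (K : ℝ) ^ 3 := one_le_pow₀ hK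
    nlinarith [mul_nonneg (by linarith : (0 : ℝ) ≤ (K : ℝ) - 1) (by linarith : (0 : ℝ) ≤ (p : ℝ) - 2)]

theorem broomStar_eq {K p : ℕ} (hp : 2 ≤ p) (h4 : 4 ≤ K + 1 + p) :
    broomStar (K + 1) p = p * (p - 1) / 2 := by
  have h1 : {e ∈ braessEdges (broom (K + 1) p) | ∃ a b : Fin p, e = s(Sum.inr a, Sum.inr b)} =
      Sym2.map Sum.inr '' {e : Sym2 (Fin p) | ¬ e.IsDiag} := by
    ext e
    constructor
    · rintro ⟨he, a, b, rfl⟩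
      refine ⟨s(a, b), ?_, rfl⟩
      have := he.1
      simpa using this
    · rintro ⟨e, he, rfl⟩
      induction e using Sym2.ind with
      | _ a b => exact ⟨star_mem_braessEdges hp h4 (by simpa using he), a, b, rfl⟩
  unfold broomStar
  rw [h1, Set.ncard_image_of_injective _ (Sym2.map.injective Sum.inr_injective),
    ← Nat.card_coe_set_eq, Nat.card_eq_fintype_card, ← Nat.choose_two_right]
  have := Sym2.card_subtype_not_diag (α := Fin p)
  rw [Fintype.card_fin] at this
  rw [← this]
  exact Fintype.card_congr (Equiv.refl _)

theorem mixed_mul_le {K p b t : ℕ} (hp : 2 ≤ p) (hK2 : 2 ≤ K) (hK : K = b + t) (ht : 1 ≤ t)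
    {i : Fin (K + 1)} (hi : (i : ℕ) = b) (a : Fin p)
    (h : s(Sum.inl i, Sum.inr a) ∈ braessEdges (broom (K + 1) p)) : p * (t + 1) ≤ 959 * K := by
  rw [mixed_mem_braessEdges_iff hp hK ht hi] at h
  have hp' : (2 : ℝ) ≤ p := by exact_mod_cast hp
  have ht' : (1 : ℝ) ≤ t := by exact_mod_cast ht
  rcases Nat.lt_or_ge K 3 with hK3 | hK3
  · exfalso
    -- These are the two pairs not covered by `mixed_weight_lower`; the criterion fails for both.
    have : K = 2 := by omega
    subst this
    have : (t = 1 ∧ b = 1) ∨ (t = 2 ∧ b = 0) := by omega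
    rcases this with ⟨rfl, rfl⟩ | ⟨rfl, rfl⟩
    · norm_num at h
      nlinarith
    · norm_num at h
      nlinarith
  · have hcases : ((t : ℝ) = 1 ∧ (2 : ℝ) ≤ b) ∨ ((t : ℝ) = 2 ∧ (1 : ℝ) ≤ b) ∨ (3 : ℝ) ≤ t := by
      have : (t = 1 ∧ 2 ≤ b) ∨ (t = 2 ∧ 1 ≤ b) ∨ 3 ≤ t := by omega
      exact_mod_cast this
    have := mul_le_of_mixed (K := K) (p := p) (b := b) (t := t) (by exact_mod_cast hK)
      (Nat.cast_nonneg b) ht' hcases hp' h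
    exact_mod_cast this

theorem broomMixed_le {K p : ℕ} (hp : 2 ≤ p) (hK : 2 ≤ K) : broomMixed (K + 1) p ≤ 959 * K := by
  classical
  have hsub : {e ∈ braessEdges (broom (K + 1) p) |
      ∃ (i : Fin (K + 1)) (a : Fin p), e = s(Sum.inl i, Sum.inr a)} ⊆
      -- The first coordinate is the distance t + 1 between the two vertices. It has at most 959K/p
      -- values, and the p pendent vertices cancel the denominator.
      ((Finset.Icc 1 (959 * K / p) ×ˢ (Finset.univ : Finset (Fin p))).image
        fun q => s(Sum.inl (Fin.ofNat (K + 1) (K + 1 - q.1)), Sum.inr q.2) : Finset _) := by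
    rintro e ⟨he, i, a, rfl⟩
    have hi := i.2
    have hne : (i : ℕ) ≠ K := fun h => he.2.1 ((broom_adj_inl_inr i a).2 h)
    have hb := mixed_mul_le hp hK (b := i) (t := K - i) (by omega) (by omega) rfl a he
    rw [Finset.coe_image]
    refine ⟨(K - i + 1, a), ?_, ?_⟩
    · simp only [Finset.coe_product, Set.mem_prod, Finset.mem_coe, Finset.mem_Icc,
        Finset.mem_univ, and_true]
      refine ⟨by omega, ?_⟩
      rw [Nat.le_div_iff_mul_le (by omega), mul_comm]
      exact hb
    · have : Fin.ofNat (K + 1) (K + 1 - (K - i + 1)) = i := by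
        ext
        simp only [Fin.ofNat]
        rw [Nat.mod_eq_of_lt (by omega)]
        omega
      simp only [this]
  unfold broomMixed
  calc _ ≤ _ := Set.ncard_le_ncard hsub (Finset.finite_toSet _)
    _ ≤ _ := by rw [Set.ncard_coe_finset]
    _ ≤ _ := Finset.card_image_le
    _ = 959 * K / p * p := by rw [Finset.card_product]; simp
    _ ≤ _ := Nat.div_mul_le_self _ _

theorem exists_lt_of_path {K p : ℕ} {e : Sym2 (Fin (K + 1) ⊕ Fin p)}
    (he : e ∈ braessEdges (broom (K + 1) p)) (h : ∃ i j : Fin (K + 1), e = s(.inl i, .inl j)) :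
    ∃ i j : Fin (K + 1), (i : ℕ) + 2 ≤ j ∧ e = s(.inl i, .inl j) := by
  obtain ⟨i, j, rfl⟩ := h
  have h1 : (i : ℕ) ≠ j := by
    intro hij
    apply he.1
    simp [Fin.ext_iff, hij]
  have h2 : ¬ ((i : ℕ) + 1 = j ∨ (j : ℕ) + 1 = i) := fun h => he.2.1 ((broom_adj_inl_inl (p := p) i j).2 h)
  rcases Nat.lt_or_ge (i : ℕ) j with h | h
  · exact ⟨i, j, by omega, rfl⟩
  · exact ⟨j, i, by omega, Sym2.eq_swap⟩

theorem broomPath_le_sum {K p : ℕ} (hp : 2 ≤ p) (hK : 72 ≤ K) :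
    broomPath (K + 1) p ≤ 2 * ∑ r ∈ Finset.Icc 1 K, (12 * K / r + 1) := by
  classical
  set T := (Finset.Icc 1 K).sigma (fun r => Finset.range (12 * K / r + 1)) with hT
  -- `F` encodes a pair by its gap r and the distance b to the free end, `F'` by r and the distance
  -- s to the centre, matching the two alternatives of `path_upper`.
  set F : (Σ _ : ℕ, ℕ) → Sym2 (Fin (K + 1) ⊕ Fin p) := fun q =>
    s(Sum.inl (Fin.ofNat (K + 1) q.2), Sum.inl (Fin.ofNat (K + 1) (q.2 + q.1))) with hF
  set F' : (Σ _ : ℕ, ℕ) → Sym2 (Fin (K + 1) ⊕ Fin p) := fun q =>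
    s(Sum.inl (Fin.ofNat (K + 1) (K - q.2 - q.1)), Sum.inl (Fin.ofNat (K + 1) (K - q.2))) with hF'
  have hof : ∀ (i : Fin (K + 1)) (n : ℕ), n = i → Fin.ofNat (K + 1) n = i := by
    intro i n h
    ext
    simp only [Fin.ofNat]
    rw [h, Nat.mod_eq_of_lt i.2]
  have hsub : {e ∈ braessEdges (broom (K + 1) p) |
      ∃ i j : Fin (K + 1), e = s(Sum.inl i, Sum.inl j)} ⊆
      (T.image F ∪ T.image F' : Finset _) := by
    rintro e ⟨he, h⟩
    obtain ⟨i, j, hij, rfl⟩ := exists_lt_of_path he h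
    have hj := j.2
    obtain ⟨r, hr⟩ := Nat.exists_eq_add_of_le (by omega : (i : ℕ) ≤ j)
    obtain ⟨s, hs⟩ := Nat.exists_eq_add_of_le (by omega : (j : ℕ) ≤ K)
    rw [path_mem_braessEdges_iff hp (b := i) (r := r) (s := s) (by omega) (by omega) rfl hr] at he
    have hor := path_upper (K := K) (p := p) (b := (i : ℕ)) (r := r) (s := s)
      (by exact_mod_cast (by omega : K = i + r + s)) (Nat.cast_nonneg _)
      (by exact_mod_cast (by omega : 1 ≤ r)) (Nat.cast_nonneg _) (by exact_mod_cast hp)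
      (by exact_mod_cast hK) he
    rw [Finset.coe_union, Finset.coe_image, Finset.coe_image]
    rcases hor with h1 | h1
    · left
      have h1' : r * (i : ℕ) < 12 * K := by exact_mod_cast h1
      refine ⟨⟨r, i⟩, ?_, ?_⟩
      · simp only [hT, Finset.mem_coe, Finset.mem_sigma, Finset.mem_Icc, Finset.mem_range,
          Nat.lt_succ_iff]
        refine ⟨by omega, ?_⟩
        rw [Nat.le_div_iff_mul_le (by omega), mul_comm]
        exact h1'.le
      · simp only [hF]
        rw [hof i _ rfl, hof j _ hr.symm]
    · right
      have h1' : r * s < 12 * K := by exact_mod_cast h1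
      refine ⟨⟨r, s⟩, ?_, ?_⟩
      · simp only [hT, Finset.mem_coe, Finset.mem_sigma, Finset.mem_Icc, Finset.mem_range,
          Nat.lt_succ_iff]
        refine ⟨by omega, ?_⟩
        rw [Nat.le_div_iff_mul_le (by omega), mul_comm]
        exact h1'.le
      · simp only [hF']
        rw [hof i _ (by omega), hof j _ (by omega)]
  unfold broomPath
  calc _ ≤ _ := Set.ncard_le_ncard hsub (Finset.finite_toSet _)
    _ ≤ _ := by rw [Set.ncard_coe_finset]
    _ ≤ _ := Finset.card_union_le _ _
    _ ≤ T.card + T.card := add_le_add Finset.card_image_le Finset.card_image_le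
    _ = _ := by rw [hT, Finset.card_sigma]; simp only [Finset.card_range]; ring

theorem sum_le_broomPath {K p R : ℕ} (hp : 2 ≤ p) (hR : 16 * R ^ 2 ≤ K) :
    ∑ r ∈ Finset.Icc 2 R, (K / (16 * r) + 1) ≤ broomPath (K + 1) p := by
  classical
  set T := (Finset.Icc 2 R).sigma (fun r => Finset.range (K / (16 * r) + 1)) with hT
  set F : (Σ _ : ℕ, ℕ) → Sym2 (Fin (K + 1) ⊕ Fin p) := fun q =>
    s(Sum.inl (Fin.ofNat (K + 1) q.2), Sum.inl (Fin.ofNat (K + 1) (q.2 + q.1))) with hF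
  have hmem : ∀ q ∈ T, 2 ≤ q.1 ∧ 16 * q.1 ^ 2 ≤ K ∧ 16 * (q.1 * q.2) ≤ K ∧ q.2 + q.1 ≤ K := by
    rintro ⟨r, b⟩ hq
    simp only [hT, Finset.mem_sigma, Finset.mem_Icc, Finset.mem_range, Nat.lt_succ_iff] at hq
    obtain ⟨⟨h2, hrR⟩, hb⟩ := hq
    rw [Nat.le_div_iff_mul_le (by omega)] at hb
    have h3 : 16 * r ^ 2 ≤ K := le_trans (by gcongr) hR
    have h4 : 16 * (r * b) ≤ K := le_trans (by linarith) hb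
    refine ⟨h2, h3, h4, ?_⟩
    show b + r ≤ K
    nlinarith
  have hval : ∀ n, n ≤ K → ((Fin.ofNat (K + 1) n : Fin (K + 1)) : ℕ) = n := fun n hn =>
    Nat.mod_eq_of_lt (by omega)
  -- The pairs fit inside the path, so `Fin.ofNat` does not wrap around, and positive gaps exclude a
  -- match with the ends swapped.
  have hinj : Set.InjOn F T := by
    intro q hq q' hq' h
    obtain ⟨h1, -, -, h2⟩ := hmem q hq
    obtain ⟨h1', -, -, h2'⟩ := hmem q' hq'
    obtain ⟨r, b⟩ := q
    obtain ⟨r', b'⟩ := q'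
    simp only [hF, Sym2.eq_iff, Sum.inl.injEq, Fin.ext_iff] at h h1 h2 h1' h2'
    rw [hval b (by omega), hval b' (by omega), hval _ h2, hval _ h2'] at h
    have hb : b = b' := by omega
    have hr : r = r' := by omega
    rw [hb, hr]
  have hsub : ((T.image F : Finset _) : Set _) ⊆ {e ∈ braessEdges (broom (K + 1) p) |
      ∃ i j : Fin (K + 1), e = s(Sum.inl i, Sum.inl j)} := by
    rw [Finset.coe_image]
    rintro _ ⟨q, hq, rfl⟩
    obtain ⟨h1, h2, h3, h4⟩ := hmem q hq
    obtain ⟨r, b⟩ := q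
    simp only at h1 h2 h3 h4
    refine ⟨?_, _, _, rfl⟩
    obtain ⟨s, hs⟩ := Nat.exists_eq_add_of_le h4
    rw [path_mem_braessEdges_iff hp hs h1 (hval b (by omega)) (hval _ h4)]
    exact path_lower (by exact_mod_cast hs) (Nat.cast_nonneg b) (by exact_mod_cast h1)
      (by exact_mod_cast hp) (by exact_mod_cast h3) (by exact_mod_cast h2)
  unfold broomPath
  calc _ = T.card := by rw [hT, Finset.card_sigma]; simp only [Finset.card_range]
    _ = (T.image F).card := (Finset.card_image_of_injOn hinj).symm
    _ = _ := (Set.ncard_coe_finset _).symm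
    _ ≤ _ := Set.ncard_le_ncard hsub (Set.toFinite _)

theorem numBraess_broom_le (k p : ℕ) :
    numBraess (broom k p) ≤ broomStar k p + broomMixed k p + broomPath k p := by
  unfold numBraess broomStar broomMixed broomPath
  have h : braessEdges (broom k p) =
      ({e ∈ braessEdges (broom k p) | ∃ a b : Fin p, e = s(Sum.inr a, Sum.inr b)} ∪
      {e ∈ braessEdges (broom k p) | ∃ (i : Fin k) (a : Fin p), e = s(Sum.inl i, Sum.inr a)}) ∪
      {e ∈ braessEdges (broom k p) | ∃ i j : Fin k, e = s(Sum.inl i, Sum.inl j)} := by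
    ext e
    constructor
    · intro he
      induction e using Sym2.ind with
      | _ x y =>
        rcases x with i | a <;> rcases y with j | b
        · exact Or.inr ⟨he, i, j, rfl⟩
        · exact Or.inl (Or.inr ⟨he, i, b, rfl⟩)
        · exact Or.inl (Or.inr ⟨he, j, a, Sym2.eq_swap⟩)
        · exact Or.inl (Or.inl ⟨he, a, b, rfl⟩)
    · rintro ((h | h) | h) <;> exact h.1
  conv_lhs => rw [h]
  exact (Set.ncard_union_le _ _).trans (Nat.add_le_add_right (Set.ncard_union_le _ _) _)

theorem broomStar_add_broomPath_le (k p : ℕ) :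
    broomStar k p + broomPath k p ≤ numBraess (broom k p) := by
  unfold numBraess broomStar broomPath
  rw [← Set.ncard_union_eq _ (Set.toFinite _) (Set.toFinite _)]
  · refine Set.ncard_le_ncard ?_ (Set.toFinite _)
    rintro e (h | h) <;> exact h.1
  · rw [Set.disjoint_left]
    rintro _ ⟨-, a, b, rfl⟩ ⟨-, i, j, h⟩
    simp at h

end Counting

/-! ### Harmonic sums and asymptotics -/

section Asymptotics

theorem harmonic_cast_eq_sum (n : ℕ) :
    ((harmonic n : ℚ) : ℝ) = ∑ i ∈ Finset.Icc 1 n, (i : ℝ)⁻¹ := by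
  rw [harmonic_eq_sum_Icc]
  push_cast
  rfl

theorem eventually_le_log (x : ℝ) : ∀ᶠ k : ℕ in atTop, x ≤ Real.log k :=
  (Real.tendsto_log_atTop.comp tendsto_natCast_atTop_atTop).eventually_ge_atTop x

theorem broomPath_le_log {k p : ℕ} (hp : 2 ≤ p) (hk : 73 ≤ k) (hlog : 1 ≤ Real.log k) :
    (broomPath k p : ℝ) ≤ 50 * (k * Real.log k) := by
  obtain ⟨K, rfl⟩ : ∃ K, k = K + 1 := ⟨k - 1, by omega⟩
  have h1 : (broomPath (K + 1) p : ℝ) ≤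
      ((2 * ∑ r ∈ Finset.Icc 1 K, (12 * K / r + 1) : ℕ) : ℝ) :=
    Nat.cast_le.2 (broomPath_le_sum hp (by omega))
  have h2 : ((2 * ∑ r ∈ Finset.Icc 1 K, (12 * K / r + 1) : ℕ) : ℝ) ≤
      2 * ∑ r ∈ Finset.Icc 1 K, (12 * K * (r : ℝ)⁻¹ + 1) := by
    push_cast
    gcongr with r _
    refine Nat.cast_div_le.trans (le_of_eq ?_)
    push_cast
    rw [div_eq_mul_inv]
  have hsum : ∑ r ∈ Finset.Icc 1 K, (12 * K * (r : ℝ)⁻¹ + 1) =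
      12 * K * (harmonic K : ℚ) + K := by
    rw [Finset.sum_add_distrib, ← Finset.mul_sum, ← harmonic_cast_eq_sum]
    simp
  rw [hsum] at h2
  have h3 := harmonic_le_one_add_log K
  have hKpos : (0 : ℝ) < K := by exact_mod_cast (by omega : 0 < K)
  have h4 : Real.log K ≤ Real.log (K + 1 : ℕ) :=
    Real.log_le_log hKpos (by push_cast; linarith)
  have h5 : (12 * K : ℝ) * (harmonic K : ℚ) ≤ 12 * K * (1 + Real.log (K + 1 : ℕ)) :=
    mul_le_mul_of_nonneg_left (h3.trans (by linarith)) (by positivity)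
  set L := Real.log (K + 1 : ℕ)
  have h6 : (K : ℝ) ≤ K * L := le_mul_of_one_le_right hKpos.le hlog
  push_cast
  linarith

theorem log_le_broomPath {k p : ℕ} (hp : 2 ≤ p) (hk : 2 ≤ k) (hlog : 40 ≤ Real.log k) :
    1 / 128 * (k * Real.log k) ≤ (broomPath k p : ℝ) := by
  obtain ⟨K, rfl⟩ : ∃ K, k = K + 1 := ⟨k - 1, by omega⟩
  -- With R about √K/4, the condition 16r² ≤ K holds for all r ≤ R, while log R is still about half
  -- of log K.
  set R := Nat.sqrt K / 4 with hR
  have hRK : 16 * R ^ 2 ≤ K := by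
    have h1 : 4 * R ≤ Nat.sqrt K := by omega
    have h2 := Nat.sqrt_le' K
    have h3 := Nat.pow_le_pow_left h1 2
    linarith
  have hKR : K + 1 ≤ 16 * (R + 1) ^ 2 := by
    have h1 : Nat.sqrt K + 1 ≤ 4 * (R + 1) := by omega
    have h2 := Nat.lt_succ_sqrt K
    have h3 := Nat.pow_le_pow_left h1 2
    simp only [Nat.succ_eq_add_one] at h2
    linarith
  have h1 : ((∑ r ∈ Finset.Icc 2 R, (K / (16 * r) + 1) : ℕ) : ℝ) ≤ broomPath (K + 1) p :=
    Nat.cast_le.2 (sum_le_broomPath hp hRK)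
  have h2 : ∑ r ∈ Finset.Icc 2 R, ((K : ℝ) / 16 * (r : ℝ)⁻¹) ≤
      ((∑ r ∈ Finset.Icc 2 R, (K / (16 * r) + 1) : ℕ) : ℝ) := by
    push_cast
    refine Finset.sum_le_sum fun r hr => ?_
    have hr0 : 0 < 16 * r := by have := (Finset.mem_Icc.1 hr).1; omega
    -- The choice b = 0 supplies the + 1, which absorbs the rounding of the quotient.
    have h3 : K < (K / (16 * r) + 1) * (16 * r) := by
      have := Nat.lt_div_mul_add (a := K) hr0
      linarith
    have h4 : (K : ℝ) ≤ ((K / (16 * r) : ℕ) + 1) * (16 * r) := by exact_mod_cast h3.le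
    have hr1 : (0 : ℝ) < 16 * r := by exact_mod_cast hr0
    rw [← div_eq_mul_inv, div_div, div_le_iff₀ hr1]
    exact h4
  have h3 : ((harmonic R : ℚ) : ℝ) - 1 ≤ ∑ r ∈ Finset.Icc 2 R, (r : ℝ)⁻¹ := by
    rw [harmonic_cast_eq_sum]
    rcases Nat.eq_zero_or_pos R with h | h
    · rw [h]; simp
    · rw [← Finset.insert_Icc_add_one_left_eq_Icc h, Finset.sum_insert (by simp)]
      simp
  have h4 := log_add_one_le_harmonic R
  have h5 : Real.log (K + 1 : ℕ) ≤ Real.log 16 + 2 * Real.log (R + 1 : ℕ) := by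
    have : Real.log (K + 1 : ℕ) ≤ Real.log (16 * ((R + 1 : ℕ) : ℝ) ^ 2) :=
      Real.log_le_log (by positivity) (by exact_mod_cast hKR)
    rwa [Real.log_mul (by norm_num) (by positivity), Real.log_pow, Nat.cast_ofNat] at this
  have h6 : Real.log 16 ≤ 15 := by
    have := Real.log_le_sub_one_of_pos (by norm_num : (0 : ℝ) < 16)
    linarith
  rw [← Finset.mul_sum] at h2
  set L := Real.log (K + 1 : ℕ)
  -- The harmonic sum without its first term is at least (L - 15)/2 - 1, which is at least L/4
  -- because L ≥ 40.
  have h7 : (K : ℝ) / 16 * (L / 4) ≤ K / 16 * ∑ r ∈ Finset.Icc 2 R, (r : ℝ)⁻¹ :=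
    mul_le_mul_of_nonneg_left (by linarith) (by positivity)
  have hK1 : (1 : ℝ) ≤ K := by exact_mod_cast (by omega : 1 ≤ K)
  have h8 : L ≤ K * L := le_mul_of_one_le_left (by linarith) hK1
  push_cast
  linarith

theorem broomMixed_le_mul {k p : ℕ} (hk : 3 ≤ k) (hp : 2 ≤ p) :
    (broomMixed k p : ℝ) ≤ 959 * k := by
  obtain ⟨K, rfl⟩ : ∃ K, k = K + 1 := ⟨k - 1, by omega⟩
  have h := broomMixed_le (K := K) hp (by omega)
  exact_mod_cast h.trans (by omega)

theorem broomStar_cast {k p : ℕ} (hp : 2 ≤ p) (hk : 2 ≤ k) :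
    (broomStar k p : ℝ) = (p : ℝ) ^ 2 / 2 - p / 2 := by
  obtain ⟨K, rfl⟩ : ∃ K, k = K + 1 := ⟨k - 1, by omega⟩
  rw [broomStar_eq hp (by omega), ← Nat.choose_two_right, Nat.cast_choose_two]
  ring

/-- The linear mixed count is absorbed into k log k, whence 1009 = 959 + 50. The lower bound simply
drops the mixed pairs. -/
theorem numBraess_broom_bounds {k p : ℕ} (hp : 2 ≤ p) (hk : 73 ≤ k) (hlog : 40 ≤ Real.log k) :
    (p : ℝ) ^ 2 / 2 - p / 2 + 1 / 128 * (k * Real.log k) ≤ numBraess (broom k p) ∧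
      (numBraess (broom k p) : ℝ) ≤ (p : ℝ) ^ 2 / 2 - p / 2 + 1009 * (k * Real.log k) := by
  have h1 : ((broomStar k p + broomPath k p : ℕ) : ℝ) ≤ numBraess (broom k p) :=
    Nat.cast_le.2 (broomStar_add_broomPath_le k p)
  have h2 : (numBraess (broom k p) : ℝ) ≤
      ((broomStar k p + broomMixed k p + broomPath k p : ℕ) : ℝ) :=
    Nat.cast_le.2 (numBraess_broom_le k p)
  push_cast at h1 h2
  have h3 := broomStar_cast hp (by omega : 2 ≤ k)
  have h4 := broomMixed_le_mul (by omega : 3 ≤ k) hp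
  have h5 := log_le_broomPath hp (by omega : 2 ≤ k) hlog
  have h6 := broomPath_le_log hp hk (by linarith)
  have h7 : (k : ℝ) ≤ k * Real.log k :=
    le_mul_of_one_le_right (Nat.cast_nonneg k) (by linarith)
  constructor <;> linarith

theorem numBraess_broom_isTheta {k p : ℕ → ℕ} (hk : Tendsto k atTop atTop) (hp : ∀ n, 2 ≤ p n) :
    (fun n => (numBraess (broom (k n) (p n)) : ℝ))
      =Θ[atTop] fun n => (k n : ℝ) * Real.log (k n) + (p n : ℝ) ^ 2 := by
  have hev : ∀ᶠ n in atTop, 73 ≤ k n ∧ 40 ≤ Real.log (k n) :=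
    (hk.eventually_ge_atTop 73).and (hk.eventually (eventually_le_log 40))
  constructor
  · refine IsBigO.of_bound 1009 ?_
    filter_upwards [hev] with n hn
    have h := (numBraess_broom_bounds (hp n) hn.1 hn.2).2
    have h0 : (0 : ℝ) ≤ k n * Real.log (k n) := mul_nonneg (Nat.cast_nonneg _) (by linarith)
    rw [Real.norm_of_nonneg (Nat.cast_nonneg _), Real.norm_of_nonneg (by positivity)]
    linarith [sq_nonneg (p n : ℝ), (Nat.cast_nonneg (p n) : (0 : ℝ) ≤ p n)]
  · refine IsBigO.of_bound 128 ?_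
    filter_upwards [hev] with n hn
    have h := (numBraess_broom_bounds (hp n) hn.1 hn.2).1
    have h0 : (0 : ℝ) ≤ k n * Real.log (k n) := mul_nonneg (Nat.cast_nonneg _) (by linarith)
    have hp2 : (2 : ℝ) ≤ p n := by exact_mod_cast hp n
    rw [Real.norm_of_nonneg (Nat.cast_nonneg _), Real.norm_of_nonneg (by positivity)]
    nlinarith

theorem numBraess_broom_isEquivalent {k p : ℕ → ℕ} (hk : Tendsto k atTop atTop)
    (hp : ∀ n, 2 ≤ p n) {c : ℝ} (hc : 0 < c) (hcp : ∀ᶠ n in atTop, c * k n ≤ p n) :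
    (fun n => (numBraess (broom (k n) (p n)) : ℝ)) ~[atTop] fun n => (p n : ℝ) ^ 2 / 2 := by
  rw [IsEquivalent, isLittleO_iff]
  intro ε hε
  -- Here 4036 = 4 · 1009, so that the k log k term costs at most ε p²/4; the other ε p²/4 pays for
  -- p/2.
  have hlog : ∀ᶠ n in atTop, Real.log (k n) ≤ ε * c ^ 2 / 4036 * k n := by
    have h := (isLittleO_iff.1 Real.isLittleO_log_id_atTop)
      (by positivity : 0 < ε * c ^ 2 / 4036)
    filter_upwards [(tendsto_natCast_atTop_atTop.comp hk).eventually h] with n hn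
    simp only [Function.comp_apply, id, Real.norm_eq_abs, Nat.abs_cast] at hn
    exact (le_abs_self _).trans hn
  filter_upwards [hk.eventually_ge_atTop 73, hk.eventually (eventually_le_log 40), hcp, hlog,
    (tendsto_natCast_atTop_atTop.comp hk).eventually_ge_atTop (2 / (ε * c))]
    with n h73 h40 hck hl hlarge
  have hb := numBraess_broom_bounds (hp n) h73 h40
  have hk0 : (0 : ℝ) ≤ k n := Nat.cast_nonneg _
  have h0 : (0 : ℝ) ≤ k n * Real.log (k n) := mul_nonneg hk0 (by linarith)
  have hp0 : (0 : ℝ) ≤ p n := Nat.cast_nonneg _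
  have h1 : 1009 * (k n * Real.log (k n)) ≤ ε * (p n : ℝ) ^ 2 / 4 := by
    have e1 := mul_le_mul_of_nonneg_left hl hk0
    have e2 : (c * k n) ^ 2 ≤ (p n : ℝ) ^ 2 := pow_le_pow_left₀ (by positivity) hck 2
    have e3 := mul_le_mul_of_nonneg_left e2 hε.le
    linarith
  have h2 : (p n : ℝ) ≤ ε * (p n : ℝ) ^ 2 / 2 := by
    simp only [Function.comp_apply] at hlarge
    rw [div_le_iff₀ (by positivity)] at hlarge
    have e1 : 2 ≤ ε * p n := by
      have := mul_le_mul_of_nonneg_left hck hε.le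
      linarith
    have e2 := mul_le_mul_of_nonneg_right e1 hp0
    linarith
  simp only [Pi.sub_apply]
  rw [Real.norm_eq_abs, Real.norm_of_nonneg (by positivity), abs_le]
  constructor <;> linarith [hb.1, hb.2]

/-- A finite c strictly between 0 and β works equally when β = ∞, so the two cases need no separate
treatment. -/
theorem eventually_mul_le_of_tendsto_div {k p : ℕ → ℕ} {β : ℝ≥0∞}
    (h : Tendsto (fun n => (p n : ℝ≥0∞) / (k n : ℝ≥0∞)) atTop (𝓝 β)) (hβ : 0 < β) :
    ∃ c : ℝ, 0 < c ∧ ∀ᶠ n in atTop, c * k n ≤ p n := by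
  obtain ⟨c, hc0, hcβ⟩ := ENNReal.lt_iff_exists_nnreal_btwn.1 hβ
  refine ⟨c, by exact_mod_cast hc0, ?_⟩
  filter_upwards [h.eventually_const_lt hcβ] with n hn
  have h1 := ENNReal.mul_le_of_le_div hn.le
  exact_mod_cast h1

end Asymptotics

end

end BraessTree

theorem theorem5p1 :
    (∀ k p : ℕ, 1 ≤ k → 2 ≤ p → 4 ≤ k + p →
      BraessTree.broomStar k p = p * (p - 1) / 2) ∧
    (∃ C : ℝ, 0 < C ∧ ∀ k p : ℕ, 3 ≤ k → 2 ≤ p →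
      (BraessTree.broomMixed k p : ℝ) ≤ C * k) ∧
    (∃ c C : ℝ, 0 < c ∧ 0 < C ∧ ∃ K : ℕ, ∀ k p : ℕ, K ≤ k → 2 ≤ p →
      c * (k * Real.log k) ≤ (BraessTree.broomPath k p : ℝ) ∧
      (BraessTree.broomPath k p : ℝ) ≤ C * (k * Real.log k)) ∧
    (∀ (k p : ℕ → ℕ) (β : ℝ≥0∞), Tendsto k atTop atTop → (∀ n, 2 ≤ p n) →
      Tendsto (fun n => (p n : ℝ≥0∞) / (k n : ℝ≥0∞)) atTop (𝓝 β) →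
      (β = 0 →
        (fun n => (BraessTree.numBraess (BraessTree.broom (k n) (p n)) : ℝ))
          =Θ[atTop] fun n => (k n : ℝ) * Real.log (k n) + (p n : ℝ) ^ 2) ∧
      (0 < β →
        (fun n => (BraessTree.numBraess (BraessTree.broom (k n) (p n)) : ℝ))
          ~[atTop] fun n => (p n : ℝ) ^ 2 / 2)) := by
  refine ⟨fun k p hk hp h4 => ?_, ⟨959, by norm_num, fun k p hk hp =>
    BraessTree.broomMixed_le_mul hk hp⟩, ⟨1 / 128, 50, by norm_num, by norm_num, ?_⟩, ?_⟩
  · obtain ⟨K, rfl⟩ : ∃ K, k = K + 1 := ⟨k - 1, by omega⟩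
    exact BraessTree.broomStar_eq hp h4
  · obtain ⟨K, hK⟩ := eventually_atTop.1
      ((eventually_ge_atTop 73).and (BraessTree.eventually_le_log 40))
    refine ⟨K, fun k p hk hp => ?_⟩
    obtain ⟨h73, h40⟩ := hK k hk
    exact ⟨BraessTree.log_le_broomPath hp (by omega) h40,
      BraessTree.broomPath_le_log hp h73 (by linarith)⟩
  · intro k p β hk hp hβ
    refine ⟨fun _ => BraessTree.numBraess_broom_isTheta hk hp, fun h0 => ?_⟩
    obtain ⟨c, hc, hck⟩ := BraessTree.eventually_mul_le_of_tendsto_div hβ h0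
    exact BraessTree.numBraess_broom_isEquivalent hk hp hc hck
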